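/- Let $\mathbb F$ be a field and let $V$, $W$ be vector spaces over $\mathbb F$. Write $F(M)$ for the free Lie algebra and $T(M)$ for the tensor algebra over a vector space $M$; $T(M)$ is a Hopf algebra in which $\Delta(m)=m\otimes 1+1\otimes m$, $\epsilon(m)=0$ and $S(m)=-m$ for $m\in M$. The canonical maps $F(W)\to F(V\oplus W)\to T(V\oplus W)$, $F(W)\to T(W)$ and $T(W)\to T(V\oplus W)$ are injective and $U(F(W))=T(W)$; regard them as inclusions. Let $T(W)$ act on $F(V\oplus W)$ so that this action extends the adjoint action of $F(W)$; it is the restriction of the adjoint action $h\cdot c=\sum h_{1}\,c\,S(h_{2})$ of $T(W)$ on $T(V\oplus W)$. Let $T(W)\cdot V\subset F(V\oplus W)$ be the span of all $t\cdot v$ with $t\in T(W)$, $v\in V$. Then: 1. $T(W)\cdot V$ is the $F(W)$-submodule of $F(V\oplus W)$ generated by $V$, and it is the free $F(W)$-module (i.e. free $T(W)$-module) over $V$: the map $T(W)\otimes V\to T(W)\cdot V$, $t\otimes v\mapsto t\cdot v$, is an isomorphism. 2. The inclusion of $T(W)\cdot V$ induces an isomorphism from the free Lie algebra $F(T(W)\cdot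 V)$ onto the Lie subalgebra of $F(V\oplus W)$ generated by $T(W)\cdot V$, and an isomorphism from the tensor algebra $T(T(W)\cdot V)$ onto the associative subalgebra of $T(V\oplus W)$ generated by $T(W)\cdot V$. 3. With these identifications, $$F(V\oplus W)=F(T(W)\cdot V)\rtimes F(W)$$ as a semidirect product of Lie algebras, $F(T(W)\cdot V)$ is the ideal of $F(V\oplus W)$ generated by $V$, and $$T(V\oplus W)=T(T(W)\cdot V)\,\#\,T(W),$$ that is: the adjoint action of $T(W)$ makes $T(T(W)\cdot V)$ a $T(W)$-module algebra, multiplication $T(T(W)\cdot V)\otimes T(W)\to T(V\oplus W)$ is a linear isomorphism, and under it the product of $T(V\oplus W)$ is the smash product $(a\otimes h)(b\otimes k)=\sum a\,(h_{1}\cdot b)\otimes h_{2}k$. -/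

import Mathlib

open scoped TensorProduct

universe u v w x

attribute [local instance] LieRing.ofAssociativeRing

noncomputable section

namespace Elimination

/-! ### The free Lie algebra over a vector space -/

section FreeLie

variable (𝔽 : Type u) [Field 𝔽] (M : Type v) [AddCommGroup M] [Module 𝔽 M]

/-- The Lie ideal of the free Lie algebra over the set `M` generated by the relations which make
the canonical map from `M` linear. -/
def linearityIdeal : LieIdeal 𝔽 (FreeLieAlgebra 𝔽 M) :=
  LieSubmodule.lieSpan 𝔽 (FreeLieAlgebra 𝔽 M)
    ({z | ∃ m n : M, z = FreeLieAlgebra.of 𝔽 (m + n) -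
        (FreeLieAlgebra.of 𝔽 m + FreeLieAlgebra.of 𝔽 n)} ∪
     {z | ∃ (c : 𝔽) (m : M), z = FreeLieAlgebra.of 𝔽 (c • m) - c • FreeLieAlgebra.of 𝔽 m})

/-- The free Lie algebra `F(M)` over the vector space `M`. Its universal property is given by
`FreeLie.lift`, `FreeLie.lift_ι` and `FreeLie.hom_ext`. -/
abbrev FreeLie : Type (max u v) := FreeLieAlgebra 𝔽 M ⧸ linearityIdeal 𝔽 M

namespace FreeLie

/-- The canonical linear map `M → F(M)`. -/
def ι : M →ₗ[𝔽] FreeLie 𝔽 M where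
  toFun m := LieSubmodule.Quotient.mk' (linearityIdeal 𝔽 M) (FreeLieAlgebra.of 𝔽 m)
  map_add' m n := by
    rw [← map_add, ← sub_eq_zero, ← map_sub]
    refine (LieSubmodule.Quotient.mk_eq_zero (N := linearityIdeal 𝔽 M)).2 ?_
    exact LieSubmodule.subset_lieSpan (Or.inl ⟨m, n, rfl⟩)
  map_smul' c m := by
    rw [RingHom.id_apply, ← map_smul, ← sub_eq_zero, ← map_sub]
    refine (LieSubmodule.Quotient.mk_eq_zero (N := linearityIdeal 𝔽 M)).2 ?_
    exact LieSubmodule.subset_lieSpan (Or.inr ⟨c, m, rfl⟩)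

variable {𝔽 M} {L : Type w} [LieRing L] [LieAlgebra 𝔽 L]

theorem linearityIdeal_le_ker (f : M →ₗ[𝔽] L) :
    linearityIdeal 𝔽 M ≤ (FreeLieAlgebra.lift 𝔽 (f : M → L)).ker := by
  refine LieSubmodule.lieSpan_le.2 ?_
  rintro z (⟨m, n, rfl⟩ | ⟨c, m, rfl⟩) <;>
    simp [LieHom.mem_ker]

/-- The Lie algebra homomorphism `F(M) → L` which extends a linear map `M → L`. -/
def lift (f : M →ₗ[𝔽] L) : FreeLie 𝔽 M →ₗ⁅𝔽⁆ L :=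
  { (linearityIdeal 𝔽 M).toSubmodule.liftQ
      (FreeLieAlgebra.lift 𝔽 (f : M → L) : FreeLieAlgebra 𝔽 M →ₗ[𝔽] L)
      (fun _ hz => linearityIdeal_le_ker f hz) with
    map_lie' := by
      intro a b
      induction a using Submodule.Quotient.induction_on with | _ a
      induction b using Submodule.Quotient.induction_on with | _ b
      exact LieHom.map_lie (FreeLieAlgebra.lift 𝔽 (f : M → L)) a b }

theorem lift_ι (f : M →ₗ[𝔽] L) (m : M) : lift f (ι 𝔽 M m) = f m :=
  FreeLieAlgebra.lift_of_apply (R := 𝔽) (f : M → L) m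

theorem hom_ext {f g : FreeLie 𝔽 M →ₗ⁅𝔽⁆ L} (h : ∀ m, f (ι 𝔽 M m) = g (ι 𝔽 M m)) : f = g := by
  let q : FreeLieAlgebra 𝔽 M →ₗ⁅𝔽⁆ FreeLie 𝔽 M :=
    { (linearityIdeal 𝔽 M).toSubmodule.mkQ with map_lie' := fun {_ _} => rfl }
  have key : f.comp q = g.comp q := FreeLieAlgebra.hom_ext (fun m => h m)
  ext a
  induction a using Submodule.Quotient.induction_on with | _ a
  exact LieHom.congr_fun key a

/-- The Lie algebra homomorphism `F(M) → F(N)` induced by a linear map `M → N`. -/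
def map {N : Type w} [AddCommGroup N] [Module 𝔽 N] (f : M →ₗ[𝔽] N) :
    FreeLie 𝔽 M →ₗ⁅𝔽⁆ FreeLie 𝔽 N :=
  lift (ι 𝔽 N ∘ₗ f)

variable (𝔽 M)

/-- The canonical Lie algebra homomorphism from `F(M)` to the tensor algebra `T(M)`. -/
def toTensor : FreeLie 𝔽 M →ₗ⁅𝔽⁆ TensorAlgebra 𝔽 M :=
  lift (TensorAlgebra.ι 𝔽)

end FreeLie

end FreeLie

/-! ### The Hopf algebra structure on the tensor algebra -/

section TensorHopf

variable (𝔽 : Type u) [Field 𝔽] (M : Type v) [AddCommGroup M] [Module 𝔽 M]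

/-- The diagonal map of `T(M)`: `m ↦ m ⊗ 1 + 1 ⊗ m` for `m ∈ M`. -/
def tensorComul : TensorAlgebra 𝔽 M →ₐ[𝔽] TensorAlgebra 𝔽 M ⊗[𝔽] TensorAlgebra 𝔽 M :=
  TensorAlgebra.lift 𝔽
    ((TensorProduct.mk 𝔽 (TensorAlgebra 𝔽 M) (TensorAlgebra 𝔽 M)).flip 1 ∘ₗ TensorAlgebra.ι 𝔽 +
      TensorProduct.mk 𝔽 (TensorAlgebra 𝔽 M) (TensorAlgebra 𝔽 M) 1 ∘ₗ TensorAlgebra.ι 𝔽)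

/-- The counit of `T(M)`: `m ↦ 0` for `m ∈ M`. -/
def tensorCounit : TensorAlgebra 𝔽 M →ₐ[𝔽] 𝔽 :=
  TensorAlgebra.lift 𝔽 0

/-- The antipode of `T(M)` as a homomorphism to the opposite algebra: `m ↦ -m` for `m ∈ M`. -/
def tensorAntipodeOp : TensorAlgebra 𝔽 M →ₐ[𝔽] (TensorAlgebra 𝔽 M)ᵐᵒᵖ :=
  TensorAlgebra.lift 𝔽
    (-((MulOpposite.opLinearEquiv 𝔽).toLinearMap ∘ₗ TensorAlgebra.ι 𝔽))

theorem tensorComul_ι (m : M) : tensorComul 𝔽 M (TensorAlgebra.ι 𝔽 m) =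
    TensorAlgebra.ι 𝔽 m ⊗ₜ 1 + 1 ⊗ₜ TensorAlgebra.ι 𝔽 m := by
  simp [tensorComul]

theorem tensorCounit_ι (m : M) : tensorCounit 𝔽 M (TensorAlgebra.ι 𝔽 m) = 0 := by
  simp [tensorCounit]

theorem tensorAntipodeOp_ι (m : M) : tensorAntipodeOp 𝔽 M (TensorAlgebra.ι 𝔽 m) =
    MulOpposite.op (-TensorAlgebra.ι 𝔽 m) := by
  simp [tensorAntipodeOp]

instance tensorBialgebra : Bialgebra 𝔽 (TensorAlgebra 𝔽 M) :=
  Bialgebra.ofAlgHom (tensorComul 𝔽 M) (tensorCounit 𝔽 M)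
    (by
      ext m
      simp [tensorComul_ι, TensorProduct.add_tmul, TensorProduct.tmul_add,
        Algebra.TensorProduct.one_def, add_assoc])
    (by ext m; simp [tensorComul_ι, tensorCounit_ι])
    (by ext m; simp [tensorComul_ι, tensorCounit_ι])

instance tensorHopfStruct : HopfAlgebraStruct 𝔽 (TensorAlgebra 𝔽 M) where
  antipode := (MulOpposite.opLinearEquiv 𝔽).symm.toLinearMap ∘ₗ (tensorAntipodeOp 𝔽 M).toLinearMap

theorem tensorComul_eq (a : TensorAlgebra 𝔽 M) :
    Coalgebra.comul (R := 𝔽) a = tensorComul 𝔽 M a := rfl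

theorem tensorCounit_eq (a : TensorAlgebra 𝔽 M) :
    Coalgebra.counit (R := 𝔽) a = tensorCounit 𝔽 M a := rfl

theorem tensorAntipode_eq (a : TensorAlgebra 𝔽 M) :
    HopfAlgebraStruct.antipode 𝔽 a = (tensorAntipodeOp 𝔽 M a).unop := rfl

theorem tensorAntipode_mul (a b : TensorAlgebra 𝔽 M) :
    HopfAlgebraStruct.antipode 𝔽 (a * b) =
      HopfAlgebraStruct.antipode 𝔽 b * HopfAlgebraStruct.antipode 𝔽 a := by
  simp [tensorAntipode_eq]

theorem tensor_antipode_left (a : TensorAlgebra 𝔽 M) :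
    LinearMap.mul' 𝔽 _ ((HopfAlgebraStruct.antipode 𝔽).rTensor _ (tensorComul 𝔽 M a)) =
      algebraMap 𝔽 _ (tensorCounit 𝔽 M a) := by
  have key : ∀ (x y : TensorAlgebra 𝔽 M ⊗[𝔽] TensorAlgebra 𝔽 M) (c : 𝔽),
      LinearMap.mul' 𝔽 _ ((HopfAlgebraStruct.antipode 𝔽).rTensor _ x) = algebraMap 𝔽 _ c →
      LinearMap.mul' 𝔽 _ ((HopfAlgebraStruct.antipode 𝔽).rTensor _ (x * y)) =
        c • LinearMap.mul' 𝔽 _ ((HopfAlgebraStruct.antipode 𝔽).rTensor _ y) := by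
    intro x y c hx
    induction y using TensorProduct.induction_on with
    | zero => simp
    | add y z hy hz => simp only [mul_add, map_add, hy, hz, smul_add]
    | tmul p q =>
      have h : LinearMap.mul' 𝔽 _ ((HopfAlgebraStruct.antipode 𝔽).rTensor _ (x * p ⊗ₜ q)) =
          HopfAlgebraStruct.antipode 𝔽 p *
            LinearMap.mul' 𝔽 _ ((HopfAlgebraStruct.antipode 𝔽).rTensor _ x) * q := by
        clear hx
        induction x using TensorProduct.induction_on with
        | zero => simp
        | add x z hx hz => simp only [add_mul, mul_add, map_add, hx, hz]
        | tmul r s => simp [tensorAntipode_mul, mul_assoc]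
      rw [h, hx, ← Algebra.commutes, mul_assoc, ← Algebra.smul_def]
      simp
  induction a using TensorAlgebra.induction with
  | algebraMap r =>
    simp [Algebra.TensorProduct.algebraMap_apply, tensorAntipode_eq]
  | ι m => simp [tensorComul_ι, tensorCounit_ι, tensorAntipode_eq, tensorAntipodeOp_ι]
  | add a b ha hb => simp only [map_add, ha, hb]
  | mul a b ha hb => rw [map_mul, key _ _ _ ha, hb, map_mul, map_mul, Algebra.smul_def]

theorem tensor_antipode_right (a : TensorAlgebra 𝔽 M) :
    LinearMap.mul' 𝔽 _ ((HopfAlgebraStruct.antipode 𝔽).lTensor _ (tensorComul 𝔽 M a)) =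
      algebraMap 𝔽 _ (tensorCounit 𝔽 M a) := by
  have key : ∀ (x y : TensorAlgebra 𝔽 M ⊗[𝔽] TensorAlgebra 𝔽 M) (c : 𝔽),
      LinearMap.mul' 𝔽 _ ((HopfAlgebraStruct.antipode 𝔽).lTensor _ y) = algebraMap 𝔽 _ c →
      LinearMap.mul' 𝔽 _ ((HopfAlgebraStruct.antipode 𝔽).lTensor _ (x * y)) =
        c • LinearMap.mul' 𝔽 _ ((HopfAlgebraStruct.antipode 𝔽).lTensor _ x) := by
    intro x y c hy
    induction x using TensorProduct.induction_on with
    | zero => simp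
    | add x z hx hz => simp only [add_mul, map_add, hx, hz, smul_add]
    | tmul p q =>
      have h : LinearMap.mul' 𝔽 _ ((HopfAlgebraStruct.antipode 𝔽).lTensor _ (p ⊗ₜ q * y)) =
          p * LinearMap.mul' 𝔽 _ ((HopfAlgebraStruct.antipode 𝔽).lTensor _ y) *
            HopfAlgebraStruct.antipode 𝔽 q := by
        clear hy
        induction y using TensorProduct.induction_on with
        | zero => simp
        | add x z hx hz => simp only [add_mul, mul_add, map_add, hx, hz]
        | tmul r s => simp [tensorAntipode_mul, mul_assoc]
      rw [h, hy, ← Algebra.commutes, mul_assoc, ← Algebra.smul_def]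
      simp
  induction a using TensorAlgebra.induction with
  | algebraMap r =>
    simp [Algebra.TensorProduct.algebraMap_apply, tensorAntipode_eq]
  | ι m => simp [tensorComul_ι, tensorCounit_ι, tensorAntipode_eq, tensorAntipodeOp_ι]
  | add a b ha hb => simp only [map_add, ha, hb]
  | mul a b ha hb =>
    rw [map_mul, key _ _ _ hb, ha, map_mul, map_mul, Algebra.smul_def, Algebra.commutes]

instance tensorHopf : HopfAlgebra 𝔽 (TensorAlgebra 𝔽 M) where
  mul_antipode_rTensor_comul := LinearMap.ext (tensor_antipode_left 𝔽 M)
  mul_antipode_lTensor_comul := LinearMap.ext (tensor_antipode_right 𝔽 M)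

end TensorHopf

/-! ### Adjoint action, module algebras and smash products -/

section Smash

variable {𝔽 : Type u} [Field 𝔽] {H : Type v} [Ring H]
  {A : Type w} [Ring A] [Algebra 𝔽 A] {C : Type x} [Ring C] [Algebra 𝔽 C]

/-- For a Hopf algebra `H` and an algebra homomorphism `φ : H → C`, the adjoint action
`h · c = ∑ φ(h₁) c φ(S(h₂))` of `H` on `C`. -/
def adjointAction [HopfAlgebra 𝔽 H] (φ : H →ₐ[𝔽] C) : H →ₗ[𝔽] C →ₗ[𝔽] C :=
  TensorProduct.lift
    ((LinearMap.mul 𝔽 (Module.End 𝔽 C)).compl₁₂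
      (LinearMap.mul 𝔽 C ∘ₗ φ.toLinearMap)
      ((LinearMap.mul 𝔽 C).flip ∘ₗ φ.toLinearMap ∘ₗ HopfAlgebra.antipode 𝔽)) ∘ₗ
    Coalgebra.comul

theorem adjointAction_apply [HopfAlgebra 𝔽 H] (φ : H →ₐ[𝔽] C) (h : H) (c : C) {ι : Type*}
    (r : Coalgebra.Repr 𝔽 h ι) :
    adjointAction φ h c =
      ∑ i ∈ r.index, φ (r.left i) * c * φ (HopfAlgebra.antipode 𝔽 (r.right i)) := by
  simp [adjointAction, ← r.eq, mul_assoc]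

/-- The linear map `ρ : H → End A` makes the algebra `A` a module algebra for the bialgebra `H`:
it is a module structure with `h · (a b) = ∑ (h₁ · a) (h₂ · b)` and `h · 1 = ε(h) 1`. -/
structure IsModuleAlgebra [Bialgebra 𝔽 H] (ρ : H →ₗ[𝔽] A →ₗ[𝔽] A) : Prop where
  one_act : ∀ a : A, ρ 1 a = a
  mul_act : ∀ (g h : H) (a : A), ρ (g * h) a = ρ g (ρ h a)
  act_mul : ∀ (h : H) (a b : A), ρ h (a * b) =
    TensorProduct.lift ((LinearMap.mul 𝔽 A).compl₁₂ (ρ.flip a) (ρ.flip b)) (Coalgebra.comul h)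
  act_one : ∀ h : H, ρ h 1 = algebraMap 𝔽 A (Coalgebra.counit h)

theorem act_mul_apply [Bialgebra 𝔽 H] (ρ : H →ₗ[𝔽] A →ₗ[𝔽] A) (h : H) (a b : A) {ι : Type*}
    (r : Coalgebra.Repr 𝔽 h ι) :
    TensorProduct.lift ((LinearMap.mul 𝔽 A).compl₁₂ (ρ.flip a) (ρ.flip b)) (Coalgebra.comul h) =
      ∑ i ∈ r.index, ρ (r.left i) a * ρ (r.right i) b := by
  simp [← r.eq]

/-- The product of `a ⊗ h` and `b ⊗ k` in the smash product `A # H`, whose underlying vector space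
is `A ⊗ H`: `(a ⊗ h) (b ⊗ k) = ∑ a (h₁ · b) ⊗ h₂ k`. -/
def smashMul [Bialgebra 𝔽 H] (ρ : H →ₗ[𝔽] A →ₗ[𝔽] A) (a : A) (h : H) (b : A) (k : H) :
    A ⊗[𝔽] H :=
  TensorProduct.map (LinearMap.mulLeft 𝔽 a ∘ₗ ρ.flip b) (LinearMap.mulRight 𝔽 k)
    (Coalgebra.comul h)

theorem smashMul_apply [Bialgebra 𝔽 H] (ρ : H →ₗ[𝔽] A →ₗ[𝔽] A) (a : A) (h : H) (b : A) (k : H)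
    {ι : Type*} (r : Coalgebra.Repr 𝔽 h ι) :
    smashMul ρ a h b k = ∑ i ∈ r.index, (a * ρ (r.left i) b) ⊗ₜ[𝔽] (r.right i * k) := by
  simp [smashMul, ← r.eq]

/-- `C = A # H` for the homomorphisms `f : A → C` and `φ : H → C`: the algebra `A` has an
`H`-module algebra structure for which `f` intertwines it with the adjoint action of `H` on `C`, and
`a ⊗ h ↦ f(a) φ(h)` is a linear isomorphism from `A ⊗ H` onto `C` which carries the smash product
multiplication to the multiplication of `C`. -/
def IsSmashProduct [HopfAlgebra 𝔽 H] (f : A →ₐ[𝔽] C) (φ : H →ₐ[𝔽] C) : Prop :=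
  ∃ ρ : H →ₗ[𝔽] A →ₗ[𝔽] A, IsModuleAlgebra ρ ∧
    (∀ (h : H) (a : A), f (ρ h a) = adjointAction φ h (f a)) ∧
    ∃ e : A ⊗[𝔽] H ≃ₗ[𝔽] C,
      (∀ (a : A) (h : H), e (a ⊗ₜ h) = f a * φ h) ∧
      ∀ (a : A) (h : H) (b : A) (k : H), e (smashMul ρ a h b k) = e (a ⊗ₜ h) * e (b ⊗ₜ k)

end Smash

/-! ### The subspace `T(W) · V` -/

section Elim

variable (𝔽 : Type u) [Field 𝔽] (V : Type v) [AddCommGroup V] [Module 𝔽 V]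
  (W : Type w) [AddCommGroup W] [Module 𝔽 W]

/-- The inclusion of `V` in `F(V ⊕ W)`. -/
def inclV : V →ₗ[𝔽] FreeLie 𝔽 (V × W) :=
  FreeLie.ι 𝔽 (V × W) ∘ₗ LinearMap.inl 𝔽 V W

/-- The canonical homomorphism `F(W) → F(V ⊕ W)`. -/
def lieW : FreeLie 𝔽 W →ₗ⁅𝔽⁆ FreeLie 𝔽 (V × W) :=
  FreeLie.map (LinearMap.inr 𝔽 V W)

/-- The canonical homomorphism `T(W) → T(V ⊕ W)`. -/
def tensorW : TensorAlgebra 𝔽 W →ₐ[𝔽] TensorAlgebra 𝔽 (V × W) :=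
  TensorAlgebra.lift 𝔽 (TensorAlgebra.ι 𝔽 ∘ₗ LinearMap.inr 𝔽 V W)

/-- The action of `T(W)` on `F(V ⊕ W)` for which `w ∈ W` acts as `x ↦ ⁅w, x⁆`. -/
def lieAction : TensorAlgebra 𝔽 W →ₐ[𝔽] Module.End 𝔽 (FreeLie 𝔽 (V × W)) :=
  TensorAlgebra.lift 𝔽
    ((LieAlgebra.ad 𝔽 (FreeLie 𝔽 (V × W)) : FreeLie 𝔽 (V × W) →ₗ[𝔽] _) ∘ₗ
      FreeLie.ι 𝔽 (V × W) ∘ₗ LinearMap.inr 𝔽 V W)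

/-- The `T(W)`-submodule `T(W) · V` of `F(V ⊕ W)` generated by `V`. -/
def tensorOrbit : Submodule 𝔽 (FreeLie 𝔽 (V × W)) :=
  Submodule.span 𝔽 {x | ∃ (t : TensorAlgebra 𝔽 W) (v : V), x = lieAction 𝔽 V W t (inclV 𝔽 V W v)}

/-- The canonical Lie algebra homomorphism `F(T(W) · V) → F(V ⊕ W)`. -/
def lieOrbit : FreeLie 𝔽 (tensorOrbit 𝔽 V W) →ₗ⁅𝔽⁆ FreeLie 𝔽 (V × W) :=
  FreeLie.lift (tensorOrbit 𝔽 V W).subtype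

/-- The canonical algebra homomorphism `T(T(W) · V) → T(V ⊕ W)`. -/
def algOrbit : TensorAlgebra 𝔽 (tensorOrbit 𝔽 V W) →ₐ[𝔽] TensorAlgebra 𝔽 (V × W) :=
  TensorAlgebra.lift 𝔽
    ((FreeLie.toTensor 𝔽 (V × W) : FreeLie 𝔽 (V × W) →ₗ[𝔽] _) ∘ₗ (tensorOrbit 𝔽 V W).subtype)

end Elim

end Elimination

end

open Elimination

/-! Write N for T(W)·V. Because T(V ⊕ W) is free as an algebra, it can be made to act on T(N) ⊗
T(W): v acts by left multiplication, w by d_w ⊗ 1 + 1 ⊗ w, where d_w is the derivation of T(N)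
extending the action of w on N (`smashRep`). This is the left regular representation of the expected
smash product, written down before the decomposition is known. An element a of T(N), mapped to T(V ⊕
W), acts as left multiplication by a, so the product of a and t sends 1 ⊗ 1 to a ⊗ t, and
multiplication T(N) ⊗ T(W) → T(V ⊕ W) is injective. Its image contains 1 and is a left ideal,
because w a = [w, a] + a w and [w, a] = d_w a; hence it is everything (`bijective_of_smashRep`). The
product rule is the identity h c = ∑ (h₁·c) h₂ (`mul_eq_actMul`). The same representation with T(W)
⊗ V in place of N shows that T(W)·V is free (`orbitMap_injective`).

The Lie statements follow from the embedding F(M) ⊆ T(M) (`toTensor_injective`): applied to M = N,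
it turns injectivity of T(N) → T(V ⊕ W) into injectivity of F(N) → F(V ⊕ W). The image is an ideal
because ad w preserves N, and the projection V ⊕ W → W shows that F(W) is a complement.

The embedding is proved without the Poincaré–Birkhoff–Witt theorem. For M of finite dimension, F(M)
is residually nilpotent by its grading, and its quotients by the lower central series are solvable
of finite dimension. An element that dies in U(L) = T(M), L = F(M), dies in every such quotient
(`eq_zero_of_ι_eq_zero`): the dimension of the quotient is lowered by passing to the kernel of a
character χ, and L acts on U(ker χ) so that ker χ acts by multiplication. -/

noncomputable section

namespace Elimination

/-! ### Derivations as homomorphisms to the dual numbers -/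

section DualNumbers

variable {𝔽 : Type u} [Field 𝔽] {A : Type v} [Ring A] [Algebra 𝔽 A]

/-- The `ε`-component of an algebra homomorphism `A → A[ε]`. -/
def dualPart (F : A →ₐ[𝔽] DualNumber A) : Module.End 𝔽 A where
  toFun a := (F a).snd
  map_add' := by simp
  map_smul' := by simp

theorem dualPart_apply (F : A →ₐ[𝔽] DualNumber A) (a : A) : dualPart F a = (F a).snd := rfl

theorem dualPart_one (F : A →ₐ[𝔽] DualNumber A) : dualPart F 1 = 0 := by
  simp [dualPart_apply]

/-- Comparing ε-components of a product modulo ε² gives the Leibniz rule. Derivations of U(L) and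
T(N) are built this way, so that the universal property for homomorphisms supplies them. -/
theorem dualPart_mul (F : A →ₐ[𝔽] DualNumber A) (hF : ∀ a, (F a).fst = a) (a b : A) :
    dualPart F (a * b) = dualPart F a * b + a * dualPart F b := by
  simp [dualPart_apply, hF, add_comm]

end DualNumbers

/-! ### Elements killed in U(L) die in finite-dimensional solvable quotients -/

section UniversalEnveloping

open UniversalEnvelopingAlgebra

variable {𝔽 : Type u} [Field 𝔽] {L : Type v} [LieRing L] [LieAlgebra 𝔽 L]

/-- The Lie algebra homomorphism `L → U(L)[ε]`, `l ↦ l + ε D(l)` attached to a derivation `D`. -/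
def envelopingDualHom (D : LieDerivation 𝔽 L L) :
    L →ₗ⁅𝔽⁆ DualNumber (UniversalEnvelopingAlgebra 𝔽 L) where
  toFun l := TrivSqZeroExt.inl (ι 𝔽 l) + TrivSqZeroExt.inr (ι 𝔽 (D l))
  map_add' a b := by
    ext <;> simp
  map_smul' c a := by
    ext <;> simp
  map_lie' := by
    intro a b
    ext
    · simp [-ι_apply, LieRing.of_associative_ring_bracket]
    · simp [-ι_apply, LieRing.of_associative_ring_bracket]
      abel

theorem fst_lift_envelopingDualHom (D : LieDerivation 𝔽 L L)
    (u : UniversalEnvelopingAlgebra 𝔽 L) : (lift 𝔽 (envelopingDualHom D) u).fst = u := by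
  have h : (TrivSqZeroExt.fstHom 𝔽 _ _).comp (lift 𝔽 (envelopingDualHom D)) =
      AlgHom.id 𝔽 (UniversalEnvelopingAlgebra 𝔽 L) := by
    refine UniversalEnvelopingAlgebra.hom_ext 𝔽 (LieHom.ext fun l => ?_)
    change (lift 𝔽 (envelopingDualHom D) (ι 𝔽 l)).fst = ι 𝔽 l
    rw [lift_ι_apply]
    simp [envelopingDualHom]
  exact DFunLike.congr_fun h u

/-- The extension of a derivation of a Lie algebra to its universal enveloping algebra. -/
def envelopingDerivation (D : LieDerivation 𝔽 L L) :
    Module.End 𝔽 (UniversalEnvelopingAlgebra 𝔽 L) :=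
  dualPart (lift 𝔽 (envelopingDualHom D))

theorem envelopingDerivation_ι_mul (D : LieDerivation 𝔽 L L) (l : L)
    (u : UniversalEnvelopingAlgebra 𝔽 L) :
    envelopingDerivation D (ι 𝔽 l * u) = ι 𝔽 (D l) * u + ι 𝔽 l * envelopingDerivation D u := by
  rw [envelopingDerivation, dualPart_mul _ (fst_lift_envelopingDualHom D)]
  congr 2
  rw [dualPart_apply, lift_ι_apply]
  simp [envelopingDualHom]

/-- The derivation of an ideal given by the bracket with an element of the Lie algebra. -/
def idealDerivation (I : LieIdeal 𝔽 L) (x : L) : LieDerivation 𝔽 I I where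
  toLinearMap := LieModule.toEnd 𝔽 L I x
  leibniz' a b := by
    ext
    change ⁅x, ⁅(a : L), (b : L)⁆⁆ = ⁅(a : L), ⁅x, (b : L)⁆⁆ - ⁅(b : L), ⁅x, (a : L)⁆⁆
    rw [leibniz_lie x (a : L) (b : L), ← lie_skew (b : L) ⁅x, (a : L)⁆, sub_neg_eq_add, add_comm]

/-- The projection onto the kernel of a character `χ` along an element `x` with `χ x = 1`. -/
def kerProj (χ : L →ₗ⁅𝔽⁆ 𝔽) (x : L) (hx : χ x = 1) : L →ₗ[𝔽] χ.ker where
  toFun l := ⟨l - χ l • x, by simp [LieHom.mem_ker, hx]⟩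
  map_add' a b := by
    ext
    simp [add_smul]
    abel
  map_smul' c a := by
    ext
    simp [smul_sub, mul_smul]

/-- Expand the bracket of a = a' + χ(a)x and b = b' + χ(b)x; the result has no x-component because χ
kills brackets. This is the identity that makes `kerRepresentation` respect brackets. -/
theorem kerProj_lie (χ : L →ₗ⁅𝔽⁆ 𝔽) (x : L) (hx : χ x = 1) (a b : L) :
    kerProj χ x hx ⁅a, b⁆ = ⁅kerProj χ x hx a, kerProj χ x hx b⁆ +
      (χ a • idealDerivation χ.ker x (kerProj χ x hx b) -
        χ b • idealDerivation χ.ker x (kerProj χ x hx a)) := by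
  ext
  have h : χ ⁅a, b⁆ = 0 := by
    rw [LieHom.map_lie, LieRing.of_associative_ring_bracket, mul_comm, sub_self]
  simp [kerProj, idealDerivation, h, lie_sub, sub_lie]
  rw [← lie_skew x a, smul_neg]
  simp

/-- The representation of `L` on the universal enveloping algebra of the kernel of a character,
where this kernel acts by multiplication. -/
def kerRepresentation (χ : L →ₗ⁅𝔽⁆ 𝔽) (x : L) (hx : χ x = 1) :
    L →ₗ⁅𝔽⁆ Module.End 𝔽 (UniversalEnvelopingAlgebra 𝔽 χ.ker) :=
  { LinearMap.mul 𝔽 _ ∘ₗ (ι 𝔽 (L := χ.ker)).toLinearMap ∘ₗ kerProj χ x hx +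
      (χ : L →ₗ[𝔽] 𝔽).smulRight (envelopingDerivation (idealDerivation χ.ker x)) with
    map_lie' := by
      intro a b
      ext u
      have h : χ ⁅a, b⁆ = 0 := by
        rw [LieHom.map_lie, LieRing.of_associative_ring_bracket, mul_comm, sub_self]
      -- The commutator of the derivation D with multiplication by c is multiplication by ⁅x, c⁆,
      -- which matches `kerProj_lie`; the terms χ(a)χ(b)D² cancel.
      simp [-ι_apply, -LieIdeal.coe_bracket_of_module, h, kerProj_lie,
        LieRing.of_associative_ring_bracket, envelopingDerivation_ι_mul, mul_add, add_mul,
        smul_smul, mul_assoc, mul_comm (χ a) (χ b)]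
      abel }

/-- The representation on U(ker χ) factors through U(L), so z acts by zero; but z acts by
multiplication, and its value at 1 is its image in U(ker χ). -/
theorem ι_ker_eq_zero (χ : L →ₗ⁅𝔽⁆ 𝔽) (x : L) (hx : χ x = 1) (z : χ.ker)
    (hz : ι 𝔽 (z : L) = 0) : ι 𝔽 z = 0 := by
  have h := lift_ι_apply 𝔽 (kerRepresentation χ x hx) (z : L)
  rw [hz, map_zero] at h
  have h1 := LinearMap.congr_fun h.symm 1
  have hk : kerProj χ x hx z = z := by
    ext
    simp [kerProj, (LieHom.mem_ker).1 z.2]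
  change ι 𝔽 (kerProj χ x hx z) * 1 +
    χ z • envelopingDerivation (idealDerivation χ.ker x) 1 = 0 at h1
  rwa [(LieHom.mem_ker).1 z.2, hk, zero_smul, mul_one, add_zero] at h1

theorem character_eq_zero_of_ι_eq_zero (χ : L →ₗ⁅𝔽⁆ 𝔽) {z : L} (hz : ι 𝔽 z = 0) : χ z = 0 := by
  rw [← lift_ι_apply 𝔽 χ z, hz, map_zero]

/-- A nonzero solvable Lie algebra has a nonzero character. -/
theorem exists_character_ne_zero (𝔽 : Type u) [Field 𝔽] (Q : Type w) [LieRing Q] [LieAlgebra 𝔽 Q]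
    [LieAlgebra.IsSolvable Q] [Nontrivial Q] : ∃ χ : Q →ₗ⁅𝔽⁆ 𝔽, ∃ x, χ x = 1 := by
  -- The derived ideal is proper, and any linear functional that vanishes on it is a character; it
  -- is scaled to take the value 1 at `q`.
  have hlt := LieAlgebra.derivedSeries_lt_top_of_solvable (R := 𝔽) (L := Q)
  obtain ⟨q, -, hq⟩ := SetLike.exists_of_lt hlt
  obtain ⟨f, hf, hfI⟩ := Submodule.exists_le_ker_of_notMem
    (p := (LieAlgebra.derivedSeries 𝔽 Q 1).toSubmodule) hq
  refine ⟨{ (f q)⁻¹ • f with map_lie' := ?_ }, q, inv_mul_cancel₀ hf⟩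
  intro a b
  have hab : f ⁅a, b⁆ = 0 := hfI (LieSubmodule.lie_mem_lie (LieSubmodule.mem_top a)
    (LieSubmodule.mem_top b))
  simp [LieRing.of_associative_ring_bracket, mul_comm, hab]

/-- An element of a Lie algebra which vanishes in the universal enveloping algebra vanishes in
every finite-dimensional solvable quotient. -/
theorem eq_zero_of_ι_eq_zero {Q : Type w} [LieRing Q] [LieAlgebra 𝔽 Q] [LieAlgebra.IsSolvable Q]
    [FiniteDimensional 𝔽 Q] (π : L →ₗ⁅𝔽⁆ Q) {z : L} (hz : ι 𝔽 z = 0) : π z = 0 := by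
  obtain ⟨n, hn⟩ : ∃ n, Module.finrank 𝔽 Q = n := ⟨_, rfl⟩
  induction n using Nat.strong_induction_on generalizing L Q with | _ n ih
  rcases subsingleton_or_nontrivial Q with hQ | hQ
  · exact Subsingleton.elim _ _
  obtain ⟨χ, x, hx⟩ := exists_character_ne_zero 𝔽 Q
  have hlt : Module.finrank 𝔽 χ.ker < n := by
    rw [← hn]
    refine Submodule.finrank_lt (s := χ.ker.toSubmodule) (fun h => ?_)
    have : x ∈ χ.ker.toSubmodule := h ▸ Submodule.mem_top
    simp [hx] at this
  -- If χ ∘ π = 0, then π already lands in the smaller algebra ker χ and `L` is kept.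
  by_cases hχ : ∀ l, χ (π l) = 0
  · let π' : L →ₗ⁅𝔽⁆ χ.ker :=
      { toFun := fun l => ⟨π l, hχ l⟩
        map_add' := fun a b => Subtype.ext (map_add π a b)
        map_smul' := fun c a => Subtype.ext (map_smul π c a)
        map_lie' := fun {a b} => Subtype.ext (LieHom.map_lie π a b) }
    exact congrArg Subtype.val (ih _ hlt π' hz rfl)
  · push Not at hχ
    -- Otherwise `L` is replaced by the kernel of χ ∘ π. It contains `z`, since characters factor
    -- through U(L), and `z` still vanishes in its enveloping algebra by `ι_ker_eq_zero`.
    obtain ⟨y, hy⟩ := hχ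
    let η : L →ₗ⁅𝔽⁆ 𝔽 := χ.comp π
    let π' : η.ker →ₗ⁅𝔽⁆ χ.ker :=
      { toFun := fun l => ⟨π l, l.2⟩
        map_add' := fun a b => Subtype.ext (map_add π (a : L) b)
        map_smul' := fun c a => Subtype.ext (map_smul π c (a : L))
        map_lie' := fun {a b} => Subtype.ext (LieHom.map_lie π (a : L) b) }
    have hz' := ι_ker_eq_zero η ((η y)⁻¹ • y) (by simp [η, hy])
      ⟨z, character_eq_zero_of_ι_eq_zero η hz⟩ hz
    exact congrArg Subtype.val (ih _ hlt π' hz' rfl)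

end UniversalEnveloping

namespace FreeLie

/-! ### Induction on F(M), functoriality, and U(F(M)) = T(M) -/

section Induction

variable {𝔽 : Type u} [Field 𝔽] {M : Type v} [AddCommGroup M] [Module 𝔽 M]

-- The elements with property `p` form a Lie subalgebra; the universal property maps F(M) into it,
-- and composing with the inclusion gives the identity.
@[elab_as_elim]
theorem induction {p : FreeLie 𝔽 M → Prop} (ι : ∀ m, p (ι 𝔽 M m))
    (add : ∀ a b, p a → p b → p (a + b)) (smul : ∀ (c : 𝔽) a, p a → p (c • a))
    (lie : ∀ a b, p a → p b → p ⁅a, b⁆) (z : FreeLie 𝔽 M) : p z := by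
  let S : LieSubalgebra 𝔽 (FreeLie 𝔽 M) :=
    { carrier := {z | p z}
      add_mem' := fun ha hb => add _ _ ha hb
      zero_mem' := by
        have := smul 0 _ (ι 0)
        rwa [zero_smul] at this
      smul_mem' := fun c _ ha => smul c _ ha
      lie_mem' := fun ha hb => lie _ _ ha hb }
  let f : M →ₗ[𝔽] S := (FreeLie.ι 𝔽 M).codRestrict S.toSubmodule ι
  have h : S.incl.comp (lift f) = LieHom.id := by
    refine hom_ext fun m => ?_
    rw [LieHom.comp_apply, lift_ι]
    rfl
  have hz : ((lift f z : S) : FreeLie 𝔽 M) = z := LieHom.congr_fun h z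
  rw [← hz]
  exact (lift f z).2

theorem map_map {N : Type w} [AddCommGroup N] [Module 𝔽 N] {P : Type x} [AddCommGroup P]
    [Module 𝔽 P] (f : M →ₗ[𝔽] N) (g : N →ₗ[𝔽] P) (z : FreeLie 𝔽 M) :
    map g (map f z) = map (g ∘ₗ f) z := by
  have h : (map g).comp (map f) = map (g ∘ₗ f) := by
    refine hom_ext fun m => ?_
    simp [map, lift_ι]
  exact LieHom.congr_fun h z

theorem map_id (z : FreeLie 𝔽 M) : map LinearMap.id z = z := by
  have h : map (LinearMap.id : M →ₗ[𝔽] M) = LieHom.id := by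
    refine hom_ext fun m => ?_
    simp [map, lift_ι]
  exact LieHom.congr_fun h z

theorem toTensor_ι (m : M) : toTensor 𝔽 M (ι 𝔽 M m) = TensorAlgebra.ι 𝔽 m :=
  lift_ι _ _

theorem lift_toTensor {A : Type w} [Ring A] [Algebra 𝔽 A] (f : M →ₗ[𝔽] A) (z : FreeLie 𝔽 M) :
    TensorAlgebra.lift 𝔽 f (toTensor 𝔽 M z) = lift f z := by
  have h : (AlgHom.toLieHom (TensorAlgebra.lift 𝔽 f)).comp (toTensor 𝔽 M) = lift f := by
    refine hom_ext fun m => ?_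
    simp [toTensor_ι, lift_ι]
  exact LieHom.congr_fun h z

theorem lift_comp_ι {L : Type w} [LieRing L] [LieAlgebra 𝔽 L] (g : FreeLie 𝔽 M →ₗ⁅𝔽⁆ L)
    (z : FreeLie 𝔽 M) : lift ((g : FreeLie 𝔽 M →ₗ[𝔽] L) ∘ₗ ι 𝔽 M) z = g z := by
  refine LieHom.congr_fun (hom_ext fun m => ?_) z
  rw [lift_ι]
  rfl

/-- `U(F(M)) = T(M)`. -/
def envelopingEquiv (𝔽 : Type u) [Field 𝔽] (M : Type v) [AddCommGroup M] [Module 𝔽 M] :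
    UniversalEnvelopingAlgebra 𝔽 (FreeLie 𝔽 M) ≃ₐ[𝔽] TensorAlgebra 𝔽 M :=
  AlgEquiv.ofAlgHom (UniversalEnvelopingAlgebra.lift 𝔽 (toTensor 𝔽 M))
    (TensorAlgebra.lift 𝔽
      ((UniversalEnvelopingAlgebra.ι 𝔽 (L := FreeLie 𝔽 M)).toLinearMap ∘ₗ ι 𝔽 M))
    (by
      ext m
      simp only [AlgHom.toLinearMap_apply, LinearMap.comp_apply, AlgHom.comp_apply,
        TensorAlgebra.lift_ι_apply, AlgHom.id_apply]
      exact (UniversalEnvelopingAlgebra.lift_ι_apply 𝔽 _ _).trans (toTensor_ι m))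
    (by
      refine UniversalEnvelopingAlgebra.hom_ext 𝔽 (LieHom.ext fun z => ?_)
      change TensorAlgebra.lift 𝔽 _ (UniversalEnvelopingAlgebra.lift 𝔽 (toTensor 𝔽 M)
        (UniversalEnvelopingAlgebra.ι 𝔽 z)) = UniversalEnvelopingAlgebra.ι 𝔽 z
      rw [UniversalEnvelopingAlgebra.lift_ι_apply, lift_toTensor]
      exact lift_comp_ι (UniversalEnvelopingAlgebra.ι 𝔽) z)

theorem ι_eq_zero_of_toTensor_eq_zero {z : FreeLie 𝔽 M} (hz : toTensor 𝔽 M z = 0) :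
    UniversalEnvelopingAlgebra.ι 𝔽 z = 0 := by
  apply (envelopingEquiv 𝔽 M).injective
  rw [map_zero, ← hz]
  exact UniversalEnvelopingAlgebra.lift_ι_apply 𝔽 _ _

end Induction

/-! ### Residual nilpotence of F(M) and its finite-dimensional quotients -/

section Residual

open Polynomial

variable {𝔽 : Type u} [Field 𝔽]

/-- The coefficient of `X ^ k`, as a linear map `𝔽[X] ⊗ L → L`. -/
def tensorCoeff {L : Type v} [AddCommGroup L] [Module 𝔽 L] (k : ℕ) : 𝔽[X] ⊗[𝔽] L →ₗ[𝔽] L :=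
  TensorProduct.lid 𝔽 L ∘ₗ (lcoeff 𝔽 k).rTensor L

theorem tensorCoeff_tmul {L : Type v} [AddCommGroup L] [Module 𝔽 L] (k : ℕ) (p : 𝔽[X]) (l : L) :
    tensorCoeff k (p ⊗ₜ[𝔽] l) = p.coeff k • l := by
  simp [tensorCoeff]

/-- The monomials form a basis of 𝔽[X], so an element of 𝔽[X] ⊗ L is determined by its coefficients
in L. -/
theorem eq_zero_of_tensorCoeff_eq_zero {L : Type v} [AddCommGroup L] [Module 𝔽 L]
    {y : 𝔽[X] ⊗[𝔽] L} (h : ∀ k, tensorCoeff k y = 0) : y = 0 := by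
  have key : ∀ k, TensorProduct.equivFinsuppOfBasisLeft (basisMonomials 𝔽) y k =
      tensorCoeff k y := by
    intro k
    rw [TensorProduct.equivFinsuppOfBasisLeft_apply, tensorCoeff, LinearMap.comp_apply]
    have hk : (basisMonomials 𝔽).coord k = lcoeff 𝔽 k := by
      refine LinearMap.ext fun p => ?_
      rfl
    rw [hk]
    rfl
  apply (TensorProduct.equivFinsuppOfBasisLeft (basisMonomials 𝔽)).injective
  ext k
  rw [key, h, map_zero, Finsupp.zero_apply]

theorem tensorCoeff_lie {L : Type v} [LieRing L] [LieAlgebra 𝔽 L] (k : ℕ)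
    (y z : 𝔽[X] ⊗[𝔽] L) : tensorCoeff k ⁅y, z⁆ =
      ∑ ij ∈ Finset.HasAntidiagonal.antidiagonal k, ⁅tensorCoeff ij.1 y, tensorCoeff ij.2 z⁆ := by
  induction y using TensorProduct.induction_on with
  | zero =>
    rw [show ⁅(0 : 𝔽[X] ⊗[𝔽] L), z⁆ = 0 from zero_lie z]
    simp
  | add a b ha hb =>
    rw [show ⁅a + b, z⁆ = ⁅a, z⁆ + ⁅b, z⁆ from add_lie a b z]
    simp only [add_lie, map_add, ha, hb, Finset.sum_add_distrib]
  | tmul p a =>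
    induction z using TensorProduct.induction_on with
    | zero =>
      rw [show ⁅p ⊗ₜ[𝔽] a, (0 : 𝔽[X] ⊗[𝔽] L)⁆ = 0 from lie_zero (p ⊗ₜ[𝔽] a)]
      simp
    | add b c hb hc =>
      rw [show ⁅p ⊗ₜ[𝔽] a, b + c⁆ = ⁅p ⊗ₜ[𝔽] a, b⁆ + ⁅p ⊗ₜ[𝔽] a, c⁆ from lie_add (p ⊗ₜ[𝔽] a) b c]
      simp only [lie_add, map_add, hb, hc, Finset.sum_add_distrib]
    | tmul q b =>
      simp only [LieAlgebra.ExtendScalars.bracket_tmul, tensorCoeff_tmul, coeff_mul,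
        Finset.sum_smul]
      refine Finset.sum_congr rfl fun ij _ => ?_
      rw [smul_lie, lie_smul, smul_smul]

/-- The homomorphism which multiplies the generators by an indeterminate. -/
def degreeHom (𝔽 : Type u) [Field 𝔽] (M : Type v) [AddCommGroup M] [Module 𝔽 M] :
    FreeLie 𝔽 M →ₗ⁅𝔽⁆ 𝔽[X] ⊗[𝔽] FreeLie 𝔽 M :=
  lift (TensorProduct.mk 𝔽 𝔽[X] (FreeLie 𝔽 M) X ∘ₗ ι 𝔽 M)

variable {M : Type v} [AddCommGroup M] [Module 𝔽 M]

/-- Evaluation at X = 1 is a left inverse. The coefficients of `degreeHom z` are thus the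
homogeneous components of z, and no separate grading of F(M) is needed. -/
theorem degreeHom_injective : Function.Injective (degreeHom 𝔽 M) := by
  let f : 𝔽[X] ⊗[𝔽] FreeLie 𝔽 M →ₗ[𝔽] FreeLie 𝔽 M :=
    (TensorProduct.lid 𝔽 (FreeLie 𝔽 M)).toLinearMap ∘ₗ (leval (1 : 𝔽)).rTensor _
  have hf : ∀ y z, f ⁅y, z⁆ = ⁅f y, f z⁆ := by
    intro y z
    induction y using TensorProduct.induction_on with
    | zero =>
      rw [show ⁅(0 : 𝔽[X] ⊗[𝔽] FreeLie 𝔽 M), z⁆ = 0 from zero_lie z, map_zero, zero_lie]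
    | add a b ha hb =>
      rw [show ⁅a + b, z⁆ = ⁅a, z⁆ + ⁅b, z⁆ from add_lie a b z, map_add, map_add, add_lie, ha, hb]
    | tmul p a =>
      induction z using TensorProduct.induction_on with
      | zero =>
        rw [show ⁅p ⊗ₜ[𝔽] a, (0 : 𝔽[X] ⊗[𝔽] FreeLie 𝔽 M)⁆ = 0 from lie_zero (p ⊗ₜ[𝔽] a), map_zero, lie_zero]
      | add b c hb hc =>
        rw [show ⁅p ⊗ₜ[𝔽] a, b + c⁆ = ⁅p ⊗ₜ[𝔽] a, b⁆ + ⁅p ⊗ₜ[𝔽] a, c⁆ from lie_add (p ⊗ₜ[𝔽] a) b c,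
          map_add, map_add, lie_add, hb, hc]
      | tmul q b =>
        simp [f, leval, smul_smul, mul_comm]
  refine Function.LeftInverse.injective (g := f) fun z => ?_
  induction z using FreeLie.induction with
  | ι m => simp [degreeHom, lift_ι, f, leval]
  | add a b ha hb => rw [map_add, map_add, ha, hb]
  | smul c a ha => rw [map_smul, map_smul, ha]
  | lie a b ha hb => rw [LieHom.map_lie, hf, ha, hb]

theorem tensorCoeff_degreeHom_zero (z : FreeLie 𝔽 M) : tensorCoeff 0 (degreeHom 𝔽 M z) = 0 := by
  induction z using FreeLie.induction with
  | ι m => simp [degreeHom, lift_ι, tensorCoeff_tmul]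
  | add a b ha hb => rw [map_add, map_add, ha, hb, add_zero]
  | smul c a ha => rw [map_smul, map_smul, ha, smul_zero]
  | lie a b ha hb => simp [LieHom.map_lie, tensorCoeff_lie, ha]

/-- The lower central series is indexed from 0, with term 0 the whole algebra, so term n lives in
degrees at least n + 1. -/
theorem tensorCoeff_degreeHom_of_mem {n : ℕ} {z : FreeLie 𝔽 M}
    (hz : z ∈ LieModule.lowerCentralSeries 𝔽 (FreeLie 𝔽 M) (FreeLie 𝔽 M) n) {k : ℕ} (hk : k ≤ n) :
    tensorCoeff k (degreeHom 𝔽 M z) = 0 := by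
  induction n generalizing z k with
  | zero => rw [Nat.le_zero.1 hk, tensorCoeff_degreeHom_zero]
  | succ n ih =>
    rw [LieModule.lowerCentralSeries_succ, ← LieSubmodule.mem_toSubmodule,
      LieSubmodule.lieIdeal_oper_eq_linear_span'] at hz
    induction hz using Submodule.span_induction with
    | mem z hz =>
      obtain ⟨a, -, b, hb, rfl⟩ := hz
      rw [LieHom.map_lie, tensorCoeff_lie]
      refine Finset.sum_eq_zero fun ij hij => ?_
      rw [Finset.HasAntidiagonal.mem_antidiagonal] at hij
      -- There is no component in degree 0; once the first degree is positive, the second is at most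
      -- n and the induction hypothesis applies.
      rcases Nat.eq_zero_or_pos ij.1 with h0 | h0
      · rw [h0, tensorCoeff_degreeHom_zero, zero_lie]
      · rw [ih hb (k := ij.2) (by omega), lie_zero]
    | zero => simp
    | add a b _ _ ha hb => rw [map_add, map_add, ha, hb, add_zero]
    | smul c a _ ha => rw [map_smul, map_smul, ha, smul_zero]

theorem eq_zero_of_forall_mem_lowerCentralSeries {z : FreeLie 𝔽 M}
    (hz : ∀ n, z ∈ LieModule.lowerCentralSeries 𝔽 (FreeLie 𝔽 M) (FreeLie 𝔽 M) n) : z = 0 := by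
  apply degreeHom_injective
  rw [map_zero]
  exact eq_zero_of_tensorCoeff_eq_zero fun k => tensorCoeff_degreeHom_of_mem (hz k) le_rfl

/-- The span of the left-normed brackets of length `k + 1` in the generators. -/
def leftNormed (𝔽 : Type u) [Field 𝔽] (M : Type v) [AddCommGroup M] [Module 𝔽 M] :
    ℕ → Submodule 𝔽 (FreeLie 𝔽 M)
  | 0 => (ι 𝔽 M).range
  | k + 1 => Submodule.map₂ (LieAlgebra.ad 𝔽 (FreeLie 𝔽 M)).toLinearMap (ι 𝔽 M).range
      (leftNormed 𝔽 M k)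

theorem leftNormed_fg [FiniteDimensional 𝔽 M] (k : ℕ) : (leftNormed 𝔽 M k).FG := by
  have h : (ι 𝔽 M).range.FG := by
    rw [LinearMap.range_eq_map]
    exact (Module.Finite.fg_top (R := 𝔽) (M := M)).map _
  induction k with
  | zero => exact h
  | succ k ih => exact h.map₂ _ ih

theorem leftNormed_le_lowerCentralSeries (k : ℕ) : leftNormed 𝔽 M k ≤
    (LieModule.lowerCentralSeries 𝔽 (FreeLie 𝔽 M) (FreeLie 𝔽 M) k).toSubmodule := by
  induction k with
  | zero => simp
  | succ k ih =>
    refine Submodule.map₂_le.2 fun a _ b hb => ?_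
    rw [LieModule.lowerCentralSeries_succ]
    exact LieSubmodule.lie_mem_lie (LieSubmodule.mem_top a) (ih hb)

/-- The sum of these spans is stable under ad of each generator. The elements whose ad preserves it
form a subalgebra by the Jacobi identity, so it is an ideal; it contains the generators. -/
theorem iSup_leftNormed : ⨆ k, leftNormed 𝔽 M k = ⊤ := by
  set T := ⨆ k, leftNormed 𝔽 M k with hT
  have hι : ∀ m, ∀ s ∈ T, ⁅ι 𝔽 M m, s⁆ ∈ T := by
    intro m s hs
    have h : T ≤ T.comap (LieAlgebra.ad 𝔽 (FreeLie 𝔽 M) (ι 𝔽 M m)) := by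
      refine iSup_le fun k s hs => ?_
      exact Submodule.mem_iSup_of_mem (k + 1)
        (Submodule.apply_mem_map₂ _ (LinearMap.mem_range_self _ m) hs)
    exact h hs
  have hT' : ∀ z : FreeLie 𝔽 M, ∀ s ∈ T, ⁅z, s⁆ ∈ T := by
    intro z
    induction z using FreeLie.induction with
    | ι m => exact hι m
    | add a b ha hb => exact fun s hs => add_lie a b s ▸ T.add_mem (ha s hs) (hb s hs)
    | smul c a ha => exact fun s hs => smul_lie c a s ▸ T.smul_mem c (ha s hs)
    | lie a b ha hb =>
      exact fun s hs => lie_lie a b s ▸ T.sub_mem (ha _ (hb s hs)) (hb _ (ha s hs))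
  refine eq_top_iff.2 fun z _ => ?_
  induction z using FreeLie.induction with
  | ι m => exact Submodule.mem_iSup_of_mem 0 (LinearMap.mem_range_self _ m)
  | add a b ha hb => exact T.add_mem (ha trivial) (hb trivial)
  | smul c a ha => exact T.smul_mem c (ha trivial)
  | lie a b ha hb => exact hT' a b (hb trivial)

/-- Modulo term n only left-normed brackets of length at most n survive, and for each length they
span a finite-dimensional space. -/
theorem finiteDimensional_quotient_lowerCentralSeries [FiniteDimensional 𝔽 M] (n : ℕ) :
    FiniteDimensional 𝔽
      (FreeLie 𝔽 M ⧸ LieModule.lowerCentralSeries 𝔽 (FreeLie 𝔽 M) (FreeLie 𝔽 M) n) := by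
  let C := LieModule.lowerCentralSeries 𝔽 (FreeLie 𝔽 M) (FreeLie 𝔽 M) n
  let S := (Finset.range n).sup (leftNormed 𝔽 M)
  have hS : S.FG := Submodule.fg_finset_sup _ _ fun k _ => leftNormed_fg k
  have hSC : C.toSubmodule ⊔ S = ⊤ := by
    rw [eq_top_iff, ← iSup_leftNormed]
    refine iSup_le fun k => ?_
    rcases lt_or_ge k n with h | h
    · exact le_sup_of_le_right (Finset.le_sup (f := leftNormed 𝔽 M) (Finset.mem_range.2 h))
    · exact le_sup_of_le_left ((leftNormed_le_lowerCentralSeries k).trans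
        (LieModule.antitone_lowerCentralSeries 𝔽 _ _ h))
  have hfg : (⊤ : Submodule 𝔽 (FreeLie 𝔽 M ⧸ C.toSubmodule)).FG := by
    rw [← (Submodule.map_mkQ_eq_top _ _).2 hSC]
    exact hS.map _
  exact Module.finite_def.2 hfg

end Residual

end FreeLie

theorem isSolvable_quotient_lowerCentralSeries (𝔽 : Type u) [Field 𝔽] (L : Type v) [LieRing L]
    [LieAlgebra 𝔽 L] (n : ℕ) :
    LieAlgebra.IsSolvable (L ⧸ LieModule.lowerCentralSeries 𝔽 L L n) := by
  let π : L →ₗ⁅𝔽⁆ L ⧸ LieModule.lowerCentralSeries 𝔽 L L n :=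
    { (LieModule.lowerCentralSeries 𝔽 L L n).toSubmodule.mkQ with map_lie' := fun {_ _} => rfl }
  have hπ : Function.Surjective π := Submodule.mkQ_surjective _
  refine LieAlgebra.IsSolvable.mk (R := 𝔽) (k := n) ?_
  rw [← LieIdeal.derivedSeries_map_eq n hπ, eq_bot_iff]
  refine (LieIdeal.map_mono (LieModule.derivedSeries_le_lowerCentralSeries 𝔽 L n)).trans ?_
  refine LieIdeal.map_le_iff_le_comap.2 fun z hz => ?_
  exact (Submodule.Quotient.mk_eq_zero _).2 hz

namespace FreeLie

/-! ### The embedding of F(M) into T(M) -/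

section Injective

variable {𝔽 : Type u} [Field 𝔽] {M : Type v} [AddCommGroup M] [Module 𝔽 M]

/-- Such a `z` vanishes in U(F(M)), hence in each finite-dimensional solvable quotient by a term of
the lower central series; residual nilpotence finishes. -/
theorem eq_zero_of_toTensor_eq_zero [FiniteDimensional 𝔽 M] {z : FreeLie 𝔽 M}
    (hz : toTensor 𝔽 M z = 0) : z = 0 := by
  refine eq_zero_of_forall_mem_lowerCentralSeries fun n => ?_
  let C := LieModule.lowerCentralSeries 𝔽 (FreeLie 𝔽 M) (FreeLie 𝔽 M) n
  let π : FreeLie 𝔽 M →ₗ⁅𝔽⁆ FreeLie 𝔽 M ⧸ C :=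
    { C.toSubmodule.mkQ with map_lie' := fun {_ _} => rfl }
  have := isSolvable_quotient_lowerCentralSeries 𝔽 (FreeLie 𝔽 M) n
  have := finiteDimensional_quotient_lowerCentralSeries (𝔽 := 𝔽) (M := M) n
  exact (Submodule.Quotient.mk_eq_zero _).1
    (eq_zero_of_ι_eq_zero π (ι_eq_zero_of_toTensor_eq_zero hz))

theorem toTensor_map {N : Type w} [AddCommGroup N] [Module 𝔽 N] (f : M →ₗ[𝔽] N)
    (z : FreeLie 𝔽 M) : toTensor 𝔽 N (map f z) =
      TensorAlgebra.lift 𝔽 (TensorAlgebra.ι 𝔽 ∘ₗ f) (toTensor 𝔽 M z) := by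
  rw [lift_toTensor]
  refine LieHom.congr_fun (f := (toTensor 𝔽 N).comp (map f)) (hom_ext fun m => ?_) z
  simp [map, lift_ι, toTensor_ι]

theorem exists_finiteDimensional_mem_range (z : FreeLie 𝔽 M) :
    ∃ N : Submodule 𝔽 M, FiniteDimensional 𝔽 N ∧ z ∈ (map (𝔽 := 𝔽) N.subtype).range := by
  have mono : ∀ {N P : Submodule 𝔽 M} (_ : N ≤ P) {a : FreeLie 𝔽 M},
      a ∈ (map (𝔽 := 𝔽) N.subtype).range → a ∈ (map (𝔽 := 𝔽) P.subtype).range := by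
    rintro N P h _ ⟨b, rfl⟩
    exact ⟨map (Submodule.inclusion h) b, map_map _ _ _⟩
  induction z using FreeLie.induction with
  | ι m =>
    refine ⟨Submodule.span 𝔽 {m}, inferInstance,
      ι 𝔽 _ ⟨m, Submodule.mem_span_singleton_self m⟩, ?_⟩
    simp [map, lift_ι]
  | add a b ha hb =>
    obtain ⟨N, hN, ha⟩ := ha
    obtain ⟨P, hP, hb⟩ := hb
    exact ⟨N ⊔ P, inferInstance, add_mem (mono le_sup_left ha) (mono le_sup_right hb)⟩
  | smul c a ha =>
    obtain ⟨N, hN, ha⟩ := ha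
    exact ⟨N, hN, (map (𝔽 := 𝔽) N.subtype).range.smul_mem c ha⟩
  | lie a b ha hb =>
    obtain ⟨N, hN, ha⟩ := ha
    obtain ⟨P, hP, hb⟩ := hb
    exact ⟨N ⊔ P, inferInstance,
      LieSubalgebra.lie_mem _ (mono le_sup_left ha) (mono le_sup_right hb)⟩

/-- The free Lie algebra embeds into the tensor algebra. -/
theorem toTensor_injective (𝔽 : Type u) [Field 𝔽] (M : Type v) [AddCommGroup M] [Module 𝔽 M] :
    Function.Injective (toTensor 𝔽 M) := by
  refine (injective_iff_map_eq_zero _).2 fun z hz => ?_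
  obtain ⟨N, hN, y, rfl⟩ := exists_finiteDimensional_mem_range z
  -- A linear retraction of M onto N carries the vanishing in T(M) back to T(N), where N has finite
  -- dimension.
  obtain ⟨g, hg⟩ := N.subtype.exists_leftInverse_of_injective N.ker_subtype
  have hy : toTensor 𝔽 N y = 0 := by
    have h := toTensor_map g (map N.subtype y)
    have hz' : toTensor 𝔽 M (map N.subtype y) = 0 := hz
    rwa [map_map, hg, map_id, hz', map_zero] at h
  rw [eq_zero_of_toTensor_eq_zero hy]
  exact map_zero (map N.subtype)

end Injective

end FreeLie

/-! ### The adjoint action of T(W) -/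

section AdjointAction

variable {𝔽 : Type u} [Field 𝔽] {W : Type w} [AddCommGroup W] [Module 𝔽 W]
  {C : Type x} [Ring C] [Algebra 𝔽 C]

/-- The linear map through which the adjoint action factors. -/
def conjugation (φ : TensorAlgebra 𝔽 W →ₐ[𝔽] C) :
    TensorAlgebra 𝔽 W ⊗[𝔽] TensorAlgebra 𝔽 W →ₗ[𝔽] Module.End 𝔽 C :=
  TensorProduct.lift
    ((LinearMap.mul 𝔽 (Module.End 𝔽 C)).compl₁₂
      (LinearMap.mul 𝔽 C ∘ₗ φ.toLinearMap)
      ((LinearMap.mul 𝔽 C).flip ∘ₗ φ.toLinearMap ∘ₗ HopfAlgebra.antipode 𝔽))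

theorem conjugation_tmul (φ : TensorAlgebra 𝔽 W →ₐ[𝔽] C) (p q : TensorAlgebra 𝔽 W) (c : C) :
    conjugation φ (p ⊗ₜ q) c = φ p * c * φ (HopfAlgebra.antipode 𝔽 q) := by
  simp [conjugation, mul_assoc]

/-- The antipode reverses products, so the factors on the right of c nest correctly. As the diagonal
map is multiplicative, the adjoint action is a module structure. -/
theorem conjugation_mul (φ : TensorAlgebra 𝔽 W →ₐ[𝔽] C)
    (P Q : TensorAlgebra 𝔽 W ⊗[𝔽] TensorAlgebra 𝔽 W) :
    conjugation φ (P * Q) = conjugation φ P * conjugation φ Q := by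
  induction P using TensorProduct.induction_on with
  | zero => simp
  | add P P' h h' => simp only [add_mul, map_add, h, h']
  | tmul p p' =>
    induction Q using TensorProduct.induction_on with
    | zero => simp
    | add Q Q' h h' => simp only [mul_add, map_add, h, h']
    | tmul q q' =>
      ext c
      have h : (HopfAlgebra.antipode 𝔽 (p' * q') : TensorAlgebra 𝔽 W) =
        HopfAlgebra.antipode 𝔽 q' * HopfAlgebra.antipode 𝔽 p' := tensorAntipode_mul 𝔽 W p' q'
      simp only [Algebra.TensorProduct.tmul_mul_tmul, Module.End.mul_apply, conjugation_tmul, h,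
        map_mul, mul_assoc]

theorem adjointAction_eq (φ : TensorAlgebra 𝔽 W →ₐ[𝔽] C) (t : TensorAlgebra 𝔽 W) :
    adjointAction φ t = conjugation φ (tensorComul 𝔽 W t) := rfl

theorem adjointAction_one (φ : TensorAlgebra 𝔽 W →ₐ[𝔽] C) (c : C) : adjointAction φ 1 c = c := by
  have h : (HopfAlgebra.antipode 𝔽 (1 : TensorAlgebra 𝔽 W)) = 1 := by
    change (tensorAntipodeOp 𝔽 W 1).unop = 1
    simp
  rw [adjointAction_eq, map_one, Algebra.TensorProduct.one_def, conjugation_tmul, h]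
  simp

theorem adjointAction_mul (φ : TensorAlgebra 𝔽 W →ₐ[𝔽] C) (s t : TensorAlgebra 𝔽 W) (c : C) :
    adjointAction φ (s * t) c = adjointAction φ s (adjointAction φ t c) := by
  simp only [adjointAction_eq, map_mul, conjugation_mul, Module.End.mul_apply]

theorem adjointAction_algebraMap (φ : TensorAlgebra 𝔽 W →ₐ[𝔽] C) (r : 𝔽) (c : C) :
    adjointAction φ (algebraMap 𝔽 _ r) c = r • c := by
  rw [Algebra.algebraMap_eq_smul_one, map_smul, LinearMap.smul_apply, adjointAction_one]

theorem adjointAction_ι (φ : TensorAlgebra 𝔽 W →ₐ[𝔽] C) (y : W) (c : C) :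
    adjointAction φ (TensorAlgebra.ι 𝔽 y) c = ⁅φ (TensorAlgebra.ι 𝔽 y), c⁆ := by
  have h : (HopfAlgebra.antipode 𝔽 (1 : TensorAlgebra 𝔽 W)) = 1 := by
    change (tensorAntipodeOp 𝔽 W 1).unop = 1
    simp
  have h' : (HopfAlgebra.antipode 𝔽 (TensorAlgebra.ι 𝔽 y)) = -TensorAlgebra.ι 𝔽 y := by
    change (tensorAntipodeOp 𝔽 W (TensorAlgebra.ι 𝔽 y)).unop = _
    simp [tensorAntipodeOp_ι]
  rw [adjointAction_eq, tensorComul_ι, map_add, LinearMap.add_apply, conjugation_tmul,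
    conjugation_tmul, h, h', LieRing.of_associative_ring_bracket]
  simp [sub_eq_add_neg]

/-- A linear map which intertwines the actions of the generators intertwines the action of `T(W)`
with the adjoint action. -/
theorem apply_lift_eq_adjointAction {X : Type v} [AddCommGroup X] [Module 𝔽 X]
    (φ : TensorAlgebra 𝔽 W →ₐ[𝔽] C) (d : W →ₗ[𝔽] Module.End 𝔽 X) (f : X →ₗ[𝔽] C)
    (h : ∀ y x, f (d y x) = ⁅φ (TensorAlgebra.ι 𝔽 y), f x⁆) (t : TensorAlgebra 𝔽 W) (x : X) :
    f (TensorAlgebra.lift 𝔽 d t x) = adjointAction φ t (f x) := by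
  induction t using TensorAlgebra.induction generalizing x with
  | algebraMap r => simp [adjointAction_algebraMap]
  | ι y => rw [TensorAlgebra.lift_ι_apply, h, adjointAction_ι]
  | mul a b ha hb => rw [map_mul, Module.End.mul_apply, ha, hb, adjointAction_mul]
  | add a b ha hb => rw [map_add, LinearMap.add_apply, map_add, ha, hb, map_add,
      LinearMap.add_apply]

/-- The linear map `p ⊗ q ↦ (p · c) q`. -/
def actMul (φ : TensorAlgebra 𝔽 W →ₐ[𝔽] C) (c : C) :
    TensorAlgebra 𝔽 W ⊗[𝔽] TensorAlgebra 𝔽 W →ₗ[𝔽] C :=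
  TensorProduct.lift ((LinearMap.mul 𝔽 C).compl₁₂ ((adjointAction φ).flip c) φ.toLinearMap)

theorem actMul_tmul (φ : TensorAlgebra 𝔽 W →ₐ[𝔽] C) (c : C) (p q : TensorAlgebra 𝔽 W) :
    actMul φ c (p ⊗ₜ q) = adjointAction φ p c * φ q := by
  simp [actMul]

theorem actMul_mul_tmul (φ : TensorAlgebra 𝔽 W →ₐ[𝔽] C) (c : C)
    (P : TensorAlgebra 𝔽 W ⊗[𝔽] TensorAlgebra 𝔽 W) (p q : TensorAlgebra 𝔽 W) :
    actMul φ c (P * p ⊗ₜ q) = actMul φ (adjointAction φ p c) P * φ q := by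
  induction P using TensorProduct.induction_on with
  | zero => simp
  | add P P' h h' => simp only [add_mul, map_add, h, h']
  | tmul r s =>
    rw [Algebra.TensorProduct.tmul_mul_tmul, actMul_tmul, actMul_tmul, adjointAction_mul, map_mul,
      mul_assoc]

/-- The identity `h c = ∑ (h₁ · c) h₂`. -/
theorem mul_eq_actMul (φ : TensorAlgebra 𝔽 W →ₐ[𝔽] C) (h : TensorAlgebra 𝔽 W) (c : C) :
    φ h * c = actMul φ c (tensorComul 𝔽 W h) := by
  induction h using TensorAlgebra.induction generalizing c with
  | algebraMap r =>
    rw [AlgHom.commutes, AlgHom.commutes, Algebra.TensorProduct.algebraMap_apply, actMul_tmul,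
      adjointAction_algebraMap, map_one, mul_one, Algebra.smul_def]
  | ι y =>
    rw [tensorComul_ι, map_add, actMul_tmul, actMul_tmul, adjointAction_ι, adjointAction_one,
      LieRing.of_associative_ring_bracket, map_one, mul_one, sub_add_cancel]
  | add a b ha hb => simp only [map_add, add_mul, ha, hb]
  | mul a b ha hb =>
    have key : ∀ Q, φ a * actMul φ c Q = actMul φ c (tensorComul 𝔽 W a * Q) := by
      intro Q
      induction Q using TensorProduct.induction_on with
      | zero => simp
      | add Q Q' h h' => simp only [mul_add, map_add, h, h']
      | tmul p q => rw [actMul_tmul, actMul_mul_tmul, ← mul_assoc, ha]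
    rw [map_mul φ, mul_assoc, hb, key, map_mul (tensorComul 𝔽 W)]

end AdjointAction

/-! ### Derivations of the tensor algebra -/

section TensorDerivation

variable {𝔽 : Type u} [Field 𝔽] {N : Type v} [AddCommGroup N] [Module 𝔽 N]

/-- The homomorphism `T(N) → T(N)[ε]` with `n ↦ n + ε d(n)`. -/
def tensorDualHom (d : Module.End 𝔽 N) :
    TensorAlgebra 𝔽 N →ₐ[𝔽] DualNumber (TensorAlgebra 𝔽 N) :=
  TensorAlgebra.lift 𝔽
    { toFun := fun n => TrivSqZeroExt.inl (TensorAlgebra.ι 𝔽 n) +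
        TrivSqZeroExt.inr (TensorAlgebra.ι 𝔽 (d n))
      map_add' := fun a b => by ext <;> simp
      map_smul' := fun c a => by ext <;> simp }

theorem tensorDualHom_ι (d : Module.End 𝔽 N) (n : N) :
    tensorDualHom d (TensorAlgebra.ι 𝔽 n) =
      TrivSqZeroExt.inl (TensorAlgebra.ι 𝔽 n) + TrivSqZeroExt.inr (TensorAlgebra.ι 𝔽 (d n)) := by
  simp [tensorDualHom]

theorem fst_tensorDualHom (d : Module.End 𝔽 N) (a : TensorAlgebra 𝔽 N) :
    (tensorDualHom d a).fst = a := by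
  have h : (TrivSqZeroExt.fstHom 𝔽 _ _).comp (tensorDualHom d) =
      AlgHom.id 𝔽 (TensorAlgebra 𝔽 N) := by
    ext n
    simp [tensorDualHom_ι]
  exact DFunLike.congr_fun h a

theorem dualPart_tensorDualHom_ι (d : Module.End 𝔽 N) (n : N) :
    dualPart (tensorDualHom d) (TensorAlgebra.ι 𝔽 n) = TensorAlgebra.ι 𝔽 (d n) := by
  simp [dualPart_apply, tensorDualHom_ι]

/-- A derivation of T(N) is determined on generators. This yields linearity of `tensorDerivation` in
the endomorphism, which the dual number construction does not show directly. -/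
theorem eq_of_leibniz {D E : Module.End 𝔽 (TensorAlgebra 𝔽 N)} (hD1 : D 1 = 0) (hE1 : E 1 = 0)
    (hD : ∀ a b, D (a * b) = D a * b + a * D b) (hE : ∀ a b, E (a * b) = E a * b + a * E b)
    (h : ∀ n, D (TensorAlgebra.ι 𝔽 n) = E (TensorAlgebra.ι 𝔽 n)) : D = E := by
  ext a
  induction a using TensorAlgebra.induction with
  | algebraMap r => simp [Algebra.algebraMap_eq_smul_one, hD1, hE1]
  | ι n => exact h n
  | mul a b ha hb => rw [hD, hE, ha, hb]
  | add a b ha hb => rw [map_add, map_add, ha, hb]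

/-- The derivation of `T(N)` which extends an endomorphism of `N`. -/
def tensorDerivation (𝔽 : Type u) [Field 𝔽] (N : Type v) [AddCommGroup N] [Module 𝔽 N] :
    Module.End 𝔽 N →ₗ[𝔽] Module.End 𝔽 (TensorAlgebra 𝔽 N) where
  toFun d := dualPart (tensorDualHom d)
  map_add' d e := by
    refine eq_of_leibniz (dualPart_one _) (by simp [dualPart_one])
      (dualPart_mul _ (fst_tensorDualHom _)) (fun a b => ?_) (fun n => ?_)
    · simp only [LinearMap.add_apply, dualPart_mul _ (fst_tensorDualHom _), add_mul, mul_add]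
      abel
    · simp [dualPart_tensorDualHom_ι]
  map_smul' c d := by
    refine eq_of_leibniz (dualPart_one _) (by simp [dualPart_one])
      (dualPart_mul _ (fst_tensorDualHom _)) (fun a b => ?_) (fun n => ?_)
    · simp [dualPart_mul _ (fst_tensorDualHom _)]
    · simp [dualPart_tensorDualHom_ι]

theorem tensorDerivation_one (d : Module.End 𝔽 N) : tensorDerivation 𝔽 N d 1 = 0 :=
  dualPart_one _

theorem tensorDerivation_mul (d : Module.End 𝔽 N) (a b : TensorAlgebra 𝔽 N) :
    tensorDerivation 𝔽 N d (a * b) =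
      tensorDerivation 𝔽 N d a * b + a * tensorDerivation 𝔽 N d b :=
  dualPart_mul _ (fst_tensorDualHom d) a b

theorem tensorDerivation_ι (d : Module.End 𝔽 N) (n : N) :
    tensorDerivation 𝔽 N d (TensorAlgebra.ι 𝔽 n) = TensorAlgebra.ι 𝔽 (d n) :=
  dualPart_tensorDualHom_ι d n

/-- A homomorphism `f` on `T(N)` intertwines a derivation with a commutator as soon as it does so on
`N`. -/
theorem map_tensorDerivation {C : Type x} [Ring C] [Algebra 𝔽 C] (f : TensorAlgebra 𝔽 N →ₐ[𝔽] C)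
    (d : Module.End 𝔽 N) (c : C)
    (h : ∀ n, f (TensorAlgebra.ι 𝔽 (d n)) = ⁅c, f (TensorAlgebra.ι 𝔽 n)⁆)
    (a : TensorAlgebra 𝔽 N) : f (tensorDerivation 𝔽 N d a) = ⁅c, f a⁆ := by
  simp only [LieRing.of_associative_ring_bracket] at h ⊢
  induction a using TensorAlgebra.induction with
  | algebraMap r =>
    simp [Algebra.algebraMap_eq_smul_one, tensorDerivation_one]
  | ι n => rw [tensorDerivation_ι, h]
  | mul a b ha hb =>
    rw [tensorDerivation_mul, map_add, map_mul, map_mul, ha, hb, map_mul]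
    noncomm_ring
  | add a b ha hb =>
    rw [map_add, map_add, ha, hb, map_add]
    noncomm_ring

end TensorDerivation

/-! ### T(N) as a T(W)-module algebra and the smash product criterion -/

section ModuleAlgebra

variable {𝔽 : Type u} [Field 𝔽] {N : Type v} [AddCommGroup N] [Module 𝔽 N]
  {W : Type w} [AddCommGroup W] [Module 𝔽 W]

/-- The action of `T(W)` on `T(N)` by derivations which extends an action on `N`. -/
def tensorAction (d : W →ₗ[𝔽] Module.End 𝔽 N) :
    TensorAlgebra 𝔽 W →ₐ[𝔽] Module.End 𝔽 (TensorAlgebra 𝔽 N) :=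
  TensorAlgebra.lift 𝔽 (tensorDerivation 𝔽 N ∘ₗ d)

theorem tensorAction_ι (d : W →ₗ[𝔽] Module.End 𝔽 N) (y : W) :
    tensorAction d (TensorAlgebra.ι 𝔽 y) = tensorDerivation 𝔽 N (d y) := by
  simp [tensorAction]

/-- The linear map `p ⊗ q ↦ (p · a) (q · b)`. -/
def actActMul (d : W →ₗ[𝔽] Module.End 𝔽 N) (a b : TensorAlgebra 𝔽 N) :
    TensorAlgebra 𝔽 W ⊗[𝔽] TensorAlgebra 𝔽 W →ₗ[𝔽] TensorAlgebra 𝔽 N :=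
  TensorProduct.lift ((LinearMap.mul 𝔽 (TensorAlgebra 𝔽 N)).compl₁₂
    ((tensorAction d).toLinearMap.flip a) ((tensorAction d).toLinearMap.flip b))

theorem actActMul_tmul (d : W →ₗ[𝔽] Module.End 𝔽 N) (a b : TensorAlgebra 𝔽 N)
    (p q : TensorAlgebra 𝔽 W) :
    actActMul d a b (p ⊗ₜ q) = tensorAction d p a * tensorAction d q b := by
  simp [actActMul]

theorem actActMul_mul_tmul (d : W →ₗ[𝔽] Module.End 𝔽 N) (a b : TensorAlgebra 𝔽 N)
    (P : TensorAlgebra 𝔽 W ⊗[𝔽] TensorAlgebra 𝔽 W) (p q : TensorAlgebra 𝔽 W) :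
    actActMul d a b (P * p ⊗ₜ q) = actActMul d (tensorAction d p a) (tensorAction d q b) P := by
  induction P using TensorProduct.induction_on with
  | zero => simp
  | add P P' h h' => simp only [add_mul, map_add, h, h']
  | tmul r s =>
    simp only [Algebra.TensorProduct.tmul_mul_tmul, actActMul_tmul, map_mul, Module.End.mul_apply]

theorem tensorAction_mul_apply (d : W →ₗ[𝔽] Module.End 𝔽 N) (h : TensorAlgebra 𝔽 W)
    (a b : TensorAlgebra 𝔽 N) :
    tensorAction d h (a * b) = actActMul d a b (tensorComul 𝔽 W h) := by
  induction h using TensorAlgebra.induction generalizing a b with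
  | algebraMap r =>
    rw [AlgHom.commutes, AlgHom.commutes, Algebra.TensorProduct.algebraMap_apply, actActMul_tmul]
    simp
  | ι y =>
    simp [tensorComul_ι, actActMul_tmul, tensorAction_ι, tensorDerivation_mul]
  | add s t hs ht => simp only [map_add, LinearMap.add_apply, hs, ht]
  | mul s t hs ht =>
    have key : ∀ Q, tensorAction d s (actActMul d a b Q) =
        actActMul d a b (tensorComul 𝔽 W s * Q) := by
      intro Q
      induction Q using TensorProduct.induction_on with
      | zero => simp
      | add Q Q' h h' => simp only [mul_add, map_add, h, h']
      | tmul p q => rw [actActMul_tmul, actActMul_mul_tmul, hs]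
    rw [map_mul (tensorAction d), Module.End.mul_apply, ht, key, map_mul (tensorComul 𝔽 W)]

theorem tensorAction_apply_one (d : W →ₗ[𝔽] Module.End 𝔽 N) (h : TensorAlgebra 𝔽 W) :
    tensorAction d h 1 = algebraMap 𝔽 _ (tensorCounit 𝔽 W h) := by
  induction h using TensorAlgebra.induction with
  | algebraMap r => simp [Algebra.algebraMap_eq_smul_one]
  | ι y => simp [tensorAction_ι, tensorDerivation_one, tensorCounit_ι]
  | add s t hs ht => simp only [map_add, LinearMap.add_apply, hs, ht]
  | mul s t hs ht =>
    rw [map_mul, Module.End.mul_apply, ht, Algebra.algebraMap_eq_smul_one, map_smul, hs, map_mul,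
      map_mul, ← Algebra.smul_def, Algebra.smul_def, Algebra.smul_def, Algebra.commutes]

theorem isModuleAlgebra_tensorAction (d : W →ₗ[𝔽] Module.End 𝔽 N) :
    IsModuleAlgebra (tensorAction d).toLinearMap where
  one_act a := by simp
  mul_act g h a := by simp
  act_mul := tensorAction_mul_apply d
  act_one := tensorAction_apply_one d

/-- The criterion for a smash product with `T(W)`. -/
theorem isSmashProduct_of_bijective {C : Type x} [Ring C] [Algebra 𝔽 C]
    (f : TensorAlgebra 𝔽 N →ₐ[𝔽] C) (φ : TensorAlgebra 𝔽 W →ₐ[𝔽] C)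
    (d : W →ₗ[𝔽] Module.End 𝔽 N)
    (h : ∀ y n, f (TensorAlgebra.ι 𝔽 (d y n)) =
      ⁅φ (TensorAlgebra.ι 𝔽 y), f (TensorAlgebra.ι 𝔽 n)⁆)
    (hb : Function.Bijective (TensorProduct.lift
      ((LinearMap.mul 𝔽 C).compl₁₂ f.toLinearMap φ.toLinearMap))) :
    IsSmashProduct f φ := by
  have hf : ∀ (t : TensorAlgebra 𝔽 W) (a : TensorAlgebra 𝔽 N),
      f (tensorAction d t a) = adjointAction φ t (f a) :=
    apply_lift_eq_adjointAction φ _ f.toLinearMap fun y a =>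
      map_tensorDerivation f (d y) _ (h y) a
  refine ⟨(tensorAction d).toLinearMap, isModuleAlgebra_tensorAction d, hf,
    LinearEquiv.ofBijective _ hb, fun a t => by simp, fun a s b t => ?_⟩
  -- With P the coproduct of s, the middle factor is ∑ (s₁·f(b)) s₂, which `mul_eq_actMul`
  -- identifies with φ(s) f(b).
  have key : ∀ P, TensorProduct.lift
      ((LinearMap.mul 𝔽 C).compl₁₂ f.toLinearMap φ.toLinearMap)
      (TensorProduct.map (LinearMap.mulLeft 𝔽 a ∘ₗ (tensorAction d).toLinearMap.flip b)
        (LinearMap.mulRight 𝔽 t) P) = f a * actMul φ (f b) P * φ t := by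
    intro P
    induction P using TensorProduct.induction_on with
    | zero => simp
    | add P P' h h' => simp only [map_add, mul_add, add_mul, h, h']
    | tmul p q => simp [actMul_tmul, hf, mul_assoc]
  refine (key _).trans ?_
  rw [tensorComul_eq, ← mul_eq_actMul]
  simp [mul_assoc]

end ModuleAlgebra

/-! ### The regular representation of the smash product -/

section Regular

variable {𝔽 : Type u} [Field 𝔽] {N : Type x} [AddCommGroup N] [Module 𝔽 N]
  {V : Type v} [AddCommGroup V] [Module 𝔽 V] {W : Type w} [AddCommGroup W] [Module 𝔽 W]

variable (𝔽 N W) in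
/-- Left multiplication by `T(N)` on `T(N) ⊗ T(W)`. -/
def leftMul : TensorAlgebra 𝔽 N →ₐ[𝔽] Module.End 𝔽 (TensorAlgebra 𝔽 N ⊗[𝔽] TensorAlgebra 𝔽 W) :=
  (Algebra.lmul 𝔽 (TensorAlgebra 𝔽 N ⊗[𝔽] TensorAlgebra 𝔽 W)).comp
    Algebra.TensorProduct.includeLeft

theorem leftMul_tmul (a b : TensorAlgebra 𝔽 N) (t : TensorAlgebra 𝔽 W) :
    leftMul 𝔽 N W a (b ⊗ₜ t) = (a * b) ⊗ₜ t := by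
  simp [leftMul]

/-- The action of `T(V ⊕ W)` on `T(N) ⊗ T(W)` for which `v ∈ V` acts by left multiplication and
`w ∈ W` as on a smash product. -/
def smashRep (j : V →ₗ[𝔽] N) (d : W →ₗ[𝔽] Module.End 𝔽 N) :
    TensorAlgebra 𝔽 (V × W) →ₐ[𝔽]
      Module.End 𝔽 (TensorAlgebra 𝔽 N ⊗[𝔽] TensorAlgebra 𝔽 W) :=
  TensorAlgebra.lift 𝔽 (LinearMap.coprod
    ((leftMul 𝔽 N W).toLinearMap ∘ₗ TensorAlgebra.ι 𝔽 ∘ₗ j)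
    (LinearMap.rTensorHom (TensorAlgebra 𝔽 W) ∘ₗ tensorDerivation 𝔽 N ∘ₗ d +
      LinearMap.lTensorHom (TensorAlgebra 𝔽 N) ∘ₗ
        LinearMap.mul 𝔽 (TensorAlgebra 𝔽 W) ∘ₗ TensorAlgebra.ι 𝔽))

variable (j : V →ₗ[𝔽] N) (d : W →ₗ[𝔽] Module.End 𝔽 N)

theorem smashRep_ι_inl (y : V) :
    smashRep j d (TensorAlgebra.ι 𝔽 (y, 0)) = leftMul 𝔽 N W (TensorAlgebra.ι 𝔽 (j y)) := by
  simp [smashRep]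

theorem smashRep_ι_inr_tmul (y : W) (a : TensorAlgebra 𝔽 N) (t : TensorAlgebra 𝔽 W) :
    smashRep j d (TensorAlgebra.ι 𝔽 (0, y)) (a ⊗ₜ t) =
      tensorDerivation 𝔽 N (d y) a ⊗ₜ t + a ⊗ₜ (TensorAlgebra.ι 𝔽 y * t) := by
  simp [smashRep]

/-- By the Leibniz rule the commutator retains only the term in which the derivation hits n.
Brackets with w in F(V ⊕ W) therefore become the action d on N. -/
theorem smashRep_ι_inr_lie (y : W) (n : N) :
    ⁅smashRep j d (TensorAlgebra.ι 𝔽 (0, y)), leftMul 𝔽 N W (TensorAlgebra.ι 𝔽 n)⁆ =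
      leftMul 𝔽 N W (TensorAlgebra.ι 𝔽 (d y n)) := by
  ext a t
  simp [LieRing.of_associative_ring_bracket, smashRep_ι_inr_tmul, leftMul_tmul,
    tensorDerivation_mul, tensorDerivation_ι, TensorProduct.add_tmul]

theorem tensorW_ι (y : W) :
    tensorW 𝔽 V W (TensorAlgebra.ι 𝔽 y) = TensorAlgebra.ι 𝔽 ((0, y) : V × W) := by
  simp [tensorW]

theorem lieAction_ι (y : W) (z : FreeLie 𝔽 (V × W)) :
    lieAction 𝔽 V W (TensorAlgebra.ι 𝔽 y) z = ⁅FreeLie.ι 𝔽 (V × W) (0, y), z⁆ := by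
  simp [lieAction]

theorem smashRep_lieAction (t : TensorAlgebra 𝔽 W) {z : FreeLie 𝔽 (V × W)} {n : N}
    (h : smashRep j d (FreeLie.toTensor 𝔽 _ z) = leftMul 𝔽 N W (TensorAlgebra.ι 𝔽 n)) :
    smashRep j d (FreeLie.toTensor 𝔽 _ (lieAction 𝔽 V W t z)) =
      leftMul 𝔽 N W (TensorAlgebra.ι 𝔽 (TensorAlgebra.lift 𝔽 d t n)) := by
  induction t using TensorAlgebra.induction generalizing z n with
  | algebraMap r => simp [h]
  | ι y =>
    rw [lieAction_ι, LieHom.map_lie, FreeLie.toTensor_ι, TensorAlgebra.lift_ι_apply,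
      ← smashRep_ι_inr_lie j, ← h]
    simp [LieRing.of_associative_ring_bracket]
  | add a b ha hb => simp only [map_add, LinearMap.add_apply, ha h, hb h]
  | mul a b ha hb =>
    simp only [map_mul (lieAction 𝔽 V W), map_mul (TensorAlgebra.lift 𝔽 d), Module.End.mul_apply]
    exact ha (hb h)

theorem smashRep_lieAction_inclV (t : TensorAlgebra 𝔽 W) (y : V) :
    smashRep j d (FreeLie.toTensor 𝔽 _ (lieAction 𝔽 V W t (inclV 𝔽 V W y))) =
      leftMul 𝔽 N W (TensorAlgebra.ι 𝔽 (TensorAlgebra.lift 𝔽 d t (j y))) := by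
  refine smashRep_lieAction j d t ?_
  rw [← smashRep_ι_inl, inclV, LinearMap.comp_apply, FreeLie.toTensor_ι, LinearMap.inl_apply]

theorem smashRep_tensorW (t b : TensorAlgebra 𝔽 W) :
    smashRep j d (tensorW 𝔽 V W t) (1 ⊗ₜ b) = 1 ⊗ₜ (t * b) := by
  induction t using TensorAlgebra.induction generalizing b with
  | algebraMap r => simp [Algebra.algebraMap_eq_smul_one]
  | ι y => simp [tensorW_ι, smashRep_ι_inr_tmul, tensorDerivation_one]
  | add s t hs ht => simp only [map_add, LinearMap.add_apply, hs, ht, add_mul,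
      TensorProduct.tmul_add]
  | mul s t hs ht => rw [map_mul, map_mul, Module.End.mul_apply, ht, hs, mul_assoc]

/-- Acting on 1 ⊗ 1 inverts multiplication on the left. For surjectivity the range contains 1 and is
stable under left multiplication by V and W. -/
theorem bijective_of_smashRep (f : TensorAlgebra 𝔽 N →ₐ[𝔽] TensorAlgebra 𝔽 (V × W))
    (hf : ∀ n, smashRep j d (f (TensorAlgebra.ι 𝔽 n)) = leftMul 𝔽 N W (TensorAlgebra.ι 𝔽 n))
    (hj : ∀ y, f (TensorAlgebra.ι 𝔽 (j y)) = TensorAlgebra.ι 𝔽 (y, 0))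
    (hd : ∀ y n, f (TensorAlgebra.ι 𝔽 (d y n)) =
      ⁅TensorAlgebra.ι 𝔽 ((0, y) : V × W), f (TensorAlgebra.ι 𝔽 n)⁆) :
    Function.Bijective (TensorProduct.lift ((LinearMap.mul 𝔽 (TensorAlgebra 𝔽 (V × W))).compl₁₂
      f.toLinearMap (tensorW 𝔽 V W).toLinearMap)) := by
  set μ := TensorProduct.lift ((LinearMap.mul 𝔽 (TensorAlgebra 𝔽 (V × W))).compl₁₂
      f.toLinearMap (tensorW 𝔽 V W).toLinearMap) with hμ
  have hμt : ∀ a t, μ (a ⊗ₜ t) = f a * tensorW 𝔽 V W t := fun a t => by simp [hμ]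
  have hfa : ∀ a, smashRep j d (f a) = leftMul 𝔽 N W a := by
    have h : (smashRep j d).comp f = leftMul 𝔽 N W := by
      ext n : 2
      exact hf n
    exact fun a => DFunLike.congr_fun h a
  constructor
  · refine Function.LeftInverse.injective (g := fun z => smashRep j d z (1 ⊗ₜ 1)) fun P => ?_
    change smashRep j d (μ P) (1 ⊗ₜ 1) = P
    induction P using TensorProduct.induction_on with
    | zero => simp
    | add P Q hP hQ => rw [map_add, map_add, LinearMap.add_apply, hP, hQ]
    | tmul a t =>
      rw [hμt, map_mul, Module.End.mul_apply, smashRep_tensorW, hfa, leftMul_tmul, mul_one, mul_one]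
  · have hV : ∀ (y : V) P, TensorAlgebra.ι 𝔽 (y, (0 : W)) * μ P ∈ μ.range := by
      intro y P
      induction P using TensorProduct.induction_on with
      | zero => simp
      | add P Q hP hQ =>
        rw [map_add, mul_add]
        exact add_mem hP hQ
      | tmul a t =>
        exact ⟨(TensorAlgebra.ι 𝔽 (j y) * a) ⊗ₜ t, by rw [hμt, hμt, map_mul, hj, mul_assoc]⟩
    have hW : ∀ (y : W) P, TensorAlgebra.ι 𝔽 ((0 : V), y) * μ P ∈ μ.range := by
      intro y P
      induction P using TensorProduct.induction_on with
      | zero => simp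
      | add P Q hP hQ =>
        rw [map_add, mul_add]
        exact add_mem hP hQ
      | tmul a t =>
        -- This is w f(a) t = [w, f(a)] t + f(a) w t, with the commutator rewritten as the image of
        -- a derivation.
        refine ⟨tensorDerivation 𝔽 N (d y) a ⊗ₜ t + a ⊗ₜ (TensorAlgebra.ι 𝔽 y * t), ?_⟩
        rw [map_add, hμt, hμt, hμt, map_tensorDerivation f (d y) _ (hd y), map_mul, tensorW_ι,
          LieRing.of_associative_ring_bracket]
        noncomm_ring
    have hM : ∀ z, ∀ s ∈ μ.range, z * s ∈ μ.range := by
      intro z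
      induction z using TensorAlgebra.induction with
      | algebraMap r =>
        intro s hs
        rw [← Algebra.smul_def]
        exact μ.range.smul_mem r hs
      | ι m =>
        rintro _ ⟨P, rfl⟩
        have h : (m : V × W) = (m.1, 0) + (0, m.2) := by simp
        rw [h, map_add, add_mul]
        exact add_mem (hV _ P) (hW _ P)
      | add a b ha hb =>
        intro s hs
        rw [add_mul]
        exact add_mem (ha s hs) (hb s hs)
      | mul a b ha hb =>
        intro s hs
        rw [mul_assoc]
        exact ha _ (hb s hs)
    intro z
    have h1 : (1 : TensorAlgebra 𝔽 (V × W)) ∈ μ.range := ⟨1 ⊗ₜ 1, by simp [hμt]⟩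
    simpa using hM z 1 h1

/-- Evaluate at 1 ⊗ 1 and apply the counit to the second factor to recover the image of n in T(N).
-/
theorem leftMul_ι_injective :
    Function.Injective fun n : N => leftMul 𝔽 N W (TensorAlgebra.ι 𝔽 n) := by
  intro m n h
  have h1 := LinearMap.congr_fun h (1 ⊗ₜ 1)
  simp only [leftMul_tmul, mul_one] at h1
  have h2 := congrArg
    (TensorProduct.rid 𝔽 _ ∘ (tensorCounit 𝔽 W).toLinearMap.lTensor (TensorAlgebra 𝔽 N)) h1
  simpa [TensorAlgebra.ι_leftInverse.injective.eq_iff] using h2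

end Regular

/-! ### Freeness of T(W)·V and the smash product decomposition -/

section Orbit

variable (𝔽 : Type u) [Field 𝔽] (V : Type v) [AddCommGroup V] [Module 𝔽 V]
  (W : Type w) [AddCommGroup W] [Module 𝔽 W]

/-- The linear map `T(W) ⊗ V → F(V ⊕ W)`, `t ⊗ v ↦ t · v`. -/
def orbitMap : TensorAlgebra 𝔽 W ⊗[𝔽] V →ₗ[𝔽] FreeLie 𝔽 (V × W) :=
  TensorProduct.lift ((lieAction 𝔽 V W).toLinearMap.compl₂ (inclV 𝔽 V W))

variable {𝔽 V W}

theorem orbitMap_tmul (t : TensorAlgebra 𝔽 W) (y : V) :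
    orbitMap 𝔽 V W (t ⊗ₜ y) = lieAction 𝔽 V W t (inclV 𝔽 V W y) := by
  simp [orbitMap]

theorem range_orbitMap : (orbitMap 𝔽 V W).range = tensorOrbit 𝔽 V W := by
  rw [LinearMap.range_eq_map, ← TensorProduct.span_tmul_eq_top, Submodule.map_span, tensorOrbit]
  congr 1
  ext z
  constructor
  · rintro ⟨_, ⟨t, y, rfl⟩, rfl⟩
    exact ⟨t, y, orbitMap_tmul t y⟩
  · rintro ⟨t, y, rfl⟩
    exact ⟨_, ⟨t, y, rfl⟩, orbitMap_tmul t y⟩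

/-- Take N = T(W) ⊗ V, with j(v) = 1 ⊗ v and w acting by left multiplication: then the image of n in
T(V ⊕ W) acts as left multiplication by n, which determines n. -/
theorem orbitMap_injective : Function.Injective (orbitMap 𝔽 V W) := by
  let j : V →ₗ[𝔽] TensorAlgebra 𝔽 W ⊗[𝔽] V := TensorProduct.mk 𝔽 _ _ 1
  let d : W →ₗ[𝔽] Module.End 𝔽 (TensorAlgebra 𝔽 W ⊗[𝔽] V) :=
    LinearMap.rTensorHom V ∘ₗ LinearMap.mul 𝔽 (TensorAlgebra 𝔽 W) ∘ₗ TensorAlgebra.ι 𝔽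
  have hd : ∀ t s (y : V), TensorAlgebra.lift 𝔽 d t (s ⊗ₜ y) = (t * s) ⊗ₜ y := by
    intro t s y
    induction t using TensorAlgebra.induction generalizing s with
    | algebraMap r => simp [Algebra.algebraMap_eq_smul_one, TensorProduct.smul_tmul']
    | ι w => simp [d]
    | add a b ha hb => rw [map_add, LinearMap.add_apply, ha, hb, add_mul, TensorProduct.add_tmul]
    | mul a b ha hb => rw [map_mul, Module.End.mul_apply, hb, ha, mul_assoc]
  have key : ∀ n, smashRep j d (FreeLie.toTensor 𝔽 _ (orbitMap 𝔽 V W n)) =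
      leftMul 𝔽 _ W (TensorAlgebra.ι 𝔽 n) := by
    intro n
    induction n using TensorProduct.induction_on with
    | zero => simp
    | add m n hm hn => simp only [map_add, hm, hn]
    | tmul t y =>
      rw [orbitMap_tmul, smashRep_lieAction_inclV, TensorProduct.mk_apply, hd, mul_one]
  intro m n h
  apply leftMul_ι_injective (𝔽 := 𝔽) (W := W)
  change leftMul 𝔽 _ W (TensorAlgebra.ι 𝔽 m) = leftMul 𝔽 _ W (TensorAlgebra.ι 𝔽 n)
  rw [← key, ← key, h]

theorem lieAction_mem_tensorOrbit (t : TensorAlgebra 𝔽 W) {z : FreeLie 𝔽 (V × W)}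
    (hz : z ∈ tensorOrbit 𝔽 V W) : lieAction 𝔽 V W t z ∈ tensorOrbit 𝔽 V W := by
  have h : tensorOrbit 𝔽 V W ≤ (tensorOrbit 𝔽 V W).comap (lieAction 𝔽 V W t) := by
    refine Submodule.span_le.2 ?_
    rintro _ ⟨s, y, rfl⟩
    exact Submodule.subset_span ⟨t * s, y, by rw [map_mul, Module.End.mul_apply]⟩
  exact h hz

theorem inclV_mem_tensorOrbit (y : V) : inclV 𝔽 V W y ∈ tensorOrbit 𝔽 V W :=
  Submodule.subset_span ⟨1, y, by simp⟩

theorem lie_ι_inr_mem_tensorOrbit (y : W) {z : FreeLie 𝔽 (V × W)}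
    (hz : z ∈ tensorOrbit 𝔽 V W) : ⁅FreeLie.ι 𝔽 (V × W) (0, y), z⁆ ∈ tensorOrbit 𝔽 V W := by
  rw [← lieAction_ι]
  exact lieAction_mem_tensorOrbit _ hz

variable (𝔽 V W) in
/-- The action of `W` on `T(W) · V`. -/
def orbitAction : W →ₗ[𝔽] Module.End 𝔽 (tensorOrbit 𝔽 V W) where
  toFun y := (lieAction 𝔽 V W (TensorAlgebra.ι 𝔽 y)).restrict
    fun _ hz => lieAction_mem_tensorOrbit _ hz
  map_add' a b := by
    ext
    simp
  map_smul' c a := by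
    ext
    simp

theorem coe_orbitAction (y : W) (z : tensorOrbit 𝔽 V W) :
    (orbitAction 𝔽 V W y z : FreeLie 𝔽 (V × W)) = ⁅FreeLie.ι 𝔽 (V × W) (0, y), ↑z⁆ :=
  lieAction_ι y _

theorem coe_lift_orbitAction (t : TensorAlgebra 𝔽 W) (z : tensorOrbit 𝔽 V W) :
    (TensorAlgebra.lift 𝔽 (orbitAction 𝔽 V W) t z : FreeLie 𝔽 (V × W)) =
      lieAction 𝔽 V W t z := by
  induction t using TensorAlgebra.induction generalizing z with
  | algebraMap r => simp
  | ι y => rw [TensorAlgebra.lift_ι_apply, coe_orbitAction, lieAction_ι]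
  | add a b ha hb => simp only [map_add, LinearMap.add_apply, Submodule.coe_add, ha, hb]
  | mul a b ha hb => rw [map_mul, Module.End.mul_apply, ha, hb, map_mul, Module.End.mul_apply]

theorem algOrbit_ι (z : tensorOrbit 𝔽 V W) :
    algOrbit 𝔽 V W (TensorAlgebra.ι 𝔽 z) = FreeLie.toTensor 𝔽 (V × W) z := by
  simp [algOrbit]

theorem algOrbit_ι_orbitAction (y : W) (z : tensorOrbit 𝔽 V W) :
    algOrbit 𝔽 V W (TensorAlgebra.ι 𝔽 (orbitAction 𝔽 V W y z)) =
      ⁅TensorAlgebra.ι 𝔽 ((0, y) : V × W), algOrbit 𝔽 V W (TensorAlgebra.ι 𝔽 z)⁆ := by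
  rw [algOrbit_ι, algOrbit_ι, coe_orbitAction, LieHom.map_lie, FreeLie.toTensor_ι]

theorem smashRep_algOrbit_ι (z : tensorOrbit 𝔽 V W) :
    smashRep ((inclV 𝔽 V W).codRestrict _ inclV_mem_tensorOrbit) (orbitAction 𝔽 V W)
      (algOrbit 𝔽 V W (TensorAlgebra.ι 𝔽 z)) = leftMul 𝔽 _ W (TensorAlgebra.ι 𝔽 z) := by
  rw [algOrbit_ι]
  let g : TensorAlgebra 𝔽 W ⊗[𝔽] V →ₗ[𝔽] tensorOrbit 𝔽 V W :=
    (orbitMap 𝔽 V W).codRestrict _ fun n => range_orbitMap.le ⟨n, rfl⟩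
  have hg : ∀ n, (g n : FreeLie 𝔽 (V × W)) = orbitMap 𝔽 V W n := fun _ => rfl
  -- Writing z as the image of n makes the claim linear in n and reduces it to t ⊗ y.
  obtain ⟨n, hn⟩ := range_orbitMap.ge z.2
  obtain rfl : g n = z := Subtype.ext hn
  clear hn
  rw [hg]
  induction n using TensorProduct.induction_on with
  | zero => simp
  | add m n hm hn => simp only [map_add, hm, hn]
  | tmul t y =>
    rw [orbitMap_tmul, smashRep_lieAction_inclV]
    congr 2
    ext
    rw [coe_lift_orbitAction, hg, orbitMap_tmul]
    rfl

theorem bijective_algOrbit_mul_tensorW :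
    Function.Bijective (TensorProduct.lift ((LinearMap.mul 𝔽 (TensorAlgebra 𝔽 (V × W))).compl₁₂
      (algOrbit 𝔽 V W).toLinearMap (tensorW 𝔽 V W).toLinearMap)) :=
  bijective_of_smashRep _ _ _ smashRep_algOrbit_ι
    (fun y => by
      rw [algOrbit_ι]
      exact FreeLie.toTensor_ι _)
    algOrbit_ι_orbitAction

theorem isSmashProduct_algOrbit : IsSmashProduct (algOrbit 𝔽 V W) (tensorW 𝔽 V W) :=
  isSmashProduct_of_bijective _ _ (orbitAction 𝔽 V W)
    (fun y z => by rw [algOrbit_ι_orbitAction, tensorW_ι]) bijective_algOrbit_mul_tensorW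

/-- Restrict the multiplication isomorphism to a ⊗ 1; the counit of T(W) recovers a. -/
theorem algOrbit_injective : Function.Injective (algOrbit 𝔽 V W) := by
  intro a b h
  have h1 : a ⊗ₜ[𝔽] (1 : TensorAlgebra 𝔽 W) = b ⊗ₜ 1 :=
    bijective_algOrbit_mul_tensorW.injective (by simp [h])
  simpa using congrArg
    (TensorProduct.rid 𝔽 _ ∘ (tensorCounit 𝔽 W).toLinearMap.lTensor _) h1

/-! ### The free Lie subalgebra on T(W)·V as an ideal -/

theorem lieOrbit_ι (z : tensorOrbit 𝔽 V W) :
    lieOrbit 𝔽 V W (FreeLie.ι 𝔽 _ z) = z :=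
  FreeLie.lift_ι _ _

theorem toTensor_lieOrbit (z : FreeLie 𝔽 (tensorOrbit 𝔽 V W)) :
    FreeLie.toTensor 𝔽 _ (lieOrbit 𝔽 V W z) = algOrbit 𝔽 V W (FreeLie.toTensor 𝔽 _ z) := by
  rw [algOrbit, FreeLie.lift_toTensor]
  refine LieHom.congr_fun (f := (FreeLie.toTensor 𝔽 _).comp (lieOrbit 𝔽 V W))
    (FreeLie.hom_ext fun m => ?_) z
  rw [LieHom.comp_apply, lieOrbit_ι, FreeLie.lift_ι]
  rfl

/-- Inside the tensor algebras the map is a restriction of `algOrbit`. The embedding F(N) ⊆ T(N) is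
needed here for N = T(W)·V, which may be infinite-dimensional even when V and W are not. -/
theorem lieOrbit_injective : Function.Injective (lieOrbit 𝔽 V W) := by
  intro a b h
  apply FreeLie.toTensor_injective
  apply algOrbit_injective
  rw [← toTensor_lieOrbit, ← toTensor_lieOrbit, h]

theorem range_lieOrbit : (lieOrbit 𝔽 V W).range =
    LieSubalgebra.lieSpan 𝔽 (FreeLie 𝔽 (V × W)) (tensorOrbit 𝔽 V W : Set _) := by
  apply le_antisymm
  · rintro _ ⟨z, rfl⟩
    change lieOrbit 𝔽 V W z ∈ _
    induction z using FreeLie.induction with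
    | ι z =>
      rw [lieOrbit_ι]
      exact LieSubalgebra.subset_lieSpan z.2
    | add a b ha hb =>
      rw [map_add]
      exact add_mem ha hb
    | smul c a ha =>
      rw [map_smul]
      exact LieSubalgebra.smul_mem _ c ha
    | lie a b ha hb =>
      rw [LieHom.map_lie]
      exact LieSubalgebra.lie_mem _ ha hb
  · refine LieSubalgebra.lieSpan_le.2 fun z hz => ?_
    exact ⟨FreeLie.ι 𝔽 _ ⟨z, hz⟩, lieOrbit_ι _⟩

theorem range_algOrbit : (algOrbit 𝔽 V W).range =
    Algebra.adjoin 𝔽 (FreeLie.toTensor 𝔽 (V × W) '' (tensorOrbit 𝔽 V W : Set _)) := by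
  apply le_antisymm
  · rintro _ ⟨a, rfl⟩
    change algOrbit 𝔽 V W a ∈ _
    induction a using TensorAlgebra.induction with
    | algebraMap r =>
      rw [AlgHom.commutes]
      exact Subalgebra.algebraMap_mem _ r
    | ι z =>
      rw [algOrbit_ι]
      exact Algebra.subset_adjoin ⟨z, z.2, rfl⟩
    | add a b ha hb =>
      rw [map_add]
      exact add_mem ha hb
    | mul a b ha hb =>
      rw [map_mul]
      exact mul_mem ha hb
  · refine Algebra.adjoin_le ?_
    rintro _ ⟨z, hz, rfl⟩
    exact ⟨TensorAlgebra.ι 𝔽 ⟨z, hz⟩, algOrbit_ι _⟩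

theorem ι_prod (m : V × W) :
    FreeLie.ι 𝔽 (V × W) m = inclV 𝔽 V W m.1 + FreeLie.ι 𝔽 (V × W) (0, m.2) := by
  rw [inclV, LinearMap.comp_apply, ← map_add]
  simp

theorem inclV_mem_range_lieOrbit (y : V) : inclV 𝔽 V W y ∈ (lieOrbit 𝔽 V W).range :=
  ⟨FreeLie.ι 𝔽 _ ⟨_, inclV_mem_tensorOrbit y⟩, lieOrbit_ι _⟩

/-- V lies in the range, while ad w preserves T(W)·V and hence, being a derivation, the subalgebra
it generates. The elements that normalize the range form a subalgebra. -/
theorem lie_mem_range_lieOrbit (x : FreeLie 𝔽 (V × W)) :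
    ∀ z ∈ (lieOrbit 𝔽 V W).range, ⁅x, z⁆ ∈ (lieOrbit 𝔽 V W).range := by
  induction x using FreeLie.induction with
  | ι m =>
    rintro _ ⟨z, rfl⟩
    rw [ι_prod, add_lie]
    refine add_mem (LieSubalgebra.lie_mem _ (inclV_mem_range_lieOrbit _) ⟨z, rfl⟩) ?_
    change ⁅_, lieOrbit 𝔽 V W z⁆ ∈ _
    induction z using FreeLie.induction with
    | ι z =>
      rw [lieOrbit_ι]
      exact ⟨FreeLie.ι 𝔽 _ ⟨_, lie_ι_inr_mem_tensorOrbit m.2 z.2⟩, lieOrbit_ι _⟩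
    | add a b ha hb =>
      rw [map_add, lie_add]
      exact add_mem ha hb
    | smul c a ha =>
      rw [map_smul, lie_smul]
      exact LieSubalgebra.smul_mem _ c ha
    | lie a b ha hb =>
      rw [LieHom.map_lie, leibniz_lie]
      exact add_mem (LieSubalgebra.lie_mem _ ha ⟨b, rfl⟩)
        (LieSubalgebra.lie_mem _ ⟨a, rfl⟩ hb)
  | add a b ha hb =>
    intro z hz
    rw [add_lie]
    exact add_mem (ha z hz) (hb z hz)
  | smul c a ha =>
    intro z hz
    rw [smul_lie]
    exact LieSubalgebra.smul_mem _ c (ha z hz)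
  | lie a b ha hb =>
    intro z hz
    rw [lie_lie]
    exact sub_mem (ha _ (hb z hz)) (hb _ (ha z hz))

theorem lieSpan_inclV_eq_range_lieOrbit :
    (LieSubmodule.lieSpan 𝔽 (FreeLie 𝔽 (V × W)) (Set.range (inclV 𝔽 V W))).toSubmodule =
      (lieOrbit 𝔽 V W).range.toSubmodule := by
  set J := LieSubmodule.lieSpan 𝔽 (FreeLie 𝔽 (V × W)) (Set.range (inclV 𝔽 V W)) with hJ
  apply le_antisymm
  · let I : LieIdeal 𝔽 (FreeLie 𝔽 (V × W)) :=
      { (lieOrbit 𝔽 V W).range.toSubmodule with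
        lie_mem := fun {x z} hz => lie_mem_range_lieOrbit x z hz }
    have h : J ≤ I := by
      refine LieSubmodule.lieSpan_le.2 ?_
      rintro _ ⟨y, rfl⟩
      exact inclV_mem_range_lieOrbit y
    exact h
  · have hO : tensorOrbit 𝔽 V W ≤ J.toSubmodule := by
      refine Submodule.span_le.2 ?_
      rintro _ ⟨t, y, rfl⟩
      have hy : inclV 𝔽 V W y ∈ J := LieSubmodule.subset_lieSpan ⟨y, rfl⟩
      generalize inclV 𝔽 V W y = z at hy
      induction t using TensorAlgebra.induction generalizing z with
      | algebraMap r => simpa using J.smul_mem r hy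
      | ι w =>
        rw [lieAction_ι]
        exact J.lie_mem hy
      | add a b ha hb =>
        rw [map_add]
        exact J.toSubmodule.add_mem (ha z hy) (hb z hy)
      | mul a b ha hb =>
        rw [map_mul]
        exact ha _ (hb z hy)
    have h : (lieOrbit 𝔽 V W).range ≤ LieIdeal.toLieSubalgebra 𝔽 _ J := by
      rw [range_lieOrbit]
      exact LieSubalgebra.lieSpan_le.2 hO
    exact h

/-! ### T(W)·V as an F(W)-module and the inclusions of F(W) and T(W) -/

theorem lieW_ι (y : W) : lieW 𝔽 V W (FreeLie.ι 𝔽 W y) = FreeLie.ι 𝔽 (V × W) (0, y) := by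
  simp [lieW, FreeLie.map, FreeLie.lift_ι]

theorem lieAction_toTensor (y : FreeLie 𝔽 W) (z : FreeLie 𝔽 (V × W)) :
    lieAction 𝔽 V W (FreeLie.toTensor 𝔽 W y) z = ⁅lieW 𝔽 V W y, z⁆ := by
  have h : (AlgHom.toLieHom (lieAction 𝔽 V W)).comp (FreeLie.toTensor 𝔽 W) =
      (LieAlgebra.ad 𝔽 (FreeLie 𝔽 (V × W))).comp (lieW 𝔽 V W) := by
    refine FreeLie.hom_ext fun m => LinearMap.ext fun z => ?_
    change lieAction 𝔽 V W (FreeLie.toTensor 𝔽 W (FreeLie.ι 𝔽 W m)) z = _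
    rw [FreeLie.toTensor_ι, lieAction_ι, LieHom.comp_apply, lieW_ι, LieAlgebra.ad_apply]
  exact LinearMap.congr_fun (LieHom.congr_fun h y) z

theorem lieSpan_lieW_range_inclV :
    (LieSubmodule.lieSpan 𝔽 (lieW 𝔽 V W).range (Set.range (inclV 𝔽 V W))).toSubmodule =
      tensorOrbit 𝔽 V W := by
  set J := LieSubmodule.lieSpan 𝔽 (lieW 𝔽 V W).range (Set.range (inclV 𝔽 V W)) with hJ
  apply le_antisymm
  · let I : LieSubmodule 𝔽 (lieW 𝔽 V W).range (FreeLie 𝔽 (V × W)) :=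
      { tensorOrbit 𝔽 V W with
        lie_mem := by
          rintro ⟨_, y, rfl⟩ z hz
          change ⁅lieW 𝔽 V W y, z⁆ ∈ tensorOrbit 𝔽 V W
          rw [← lieAction_toTensor]
          exact lieAction_mem_tensorOrbit _ hz }
    have h : J ≤ I := by
      refine LieSubmodule.lieSpan_le.2 ?_
      rintro _ ⟨y, rfl⟩
      exact inclV_mem_tensorOrbit y
    exact h
  · refine Submodule.span_le.2 ?_
    rintro _ ⟨t, y, rfl⟩
    have hy : inclV 𝔽 V W y ∈ J := LieSubmodule.subset_lieSpan ⟨y, rfl⟩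
    generalize inclV 𝔽 V W y = z at hy
    induction t using TensorAlgebra.induction generalizing z with
    | algebraMap r => simpa using J.smul_mem r hy
    | ι w =>
      rw [lieAction_ι, ← lieW_ι]
      exact J.lie_mem (x := ⟨lieW 𝔽 V W (FreeLie.ι 𝔽 W w), _, rfl⟩) hy
    | add a b ha hb =>
      rw [map_add]
      exact J.toSubmodule.add_mem (ha z hy) (hb z hy)
    | mul a b ha hb =>
      rw [map_mul]
      exact ha _ (hb z hy)

theorem toTensor_lieAction (t : TensorAlgebra 𝔽 W) (z : FreeLie 𝔽 (V × W)) :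
    FreeLie.toTensor 𝔽 (V × W) (lieAction 𝔽 V W t z) =
      adjointAction (tensorW 𝔽 V W) t (FreeLie.toTensor 𝔽 (V × W) z) := by
  refine apply_lift_eq_adjointAction (tensorW 𝔽 V W) _
    (FreeLie.toTensor 𝔽 (V × W)).toLinearMap (fun y z => ?_) t z
  change FreeLie.toTensor 𝔽 _ ⁅FreeLie.ι 𝔽 (V × W) (0, y), z⁆ = ⁅_, FreeLie.toTensor 𝔽 _ z⁆
  rw [LieHom.map_lie, FreeLie.toTensor_ι, tensorW_ι]

theorem tensorW_injective : Function.Injective (tensorW 𝔽 V W) := by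
  let g : TensorAlgebra 𝔽 (V × W) →ₐ[𝔽] TensorAlgebra 𝔽 W :=
    TensorAlgebra.lift 𝔽 (TensorAlgebra.ι 𝔽 ∘ₗ LinearMap.snd 𝔽 V W)
  have h : g.comp (tensorW 𝔽 V W) = AlgHom.id 𝔽 _ := by
    ext y
    simp [g, tensorW_ι]
  exact Function.LeftInverse.injective (g := g) fun t => DFunLike.congr_fun h t

theorem map_snd_lieW (y : FreeLie 𝔽 W) : FreeLie.map (LinearMap.snd 𝔽 V W) (lieW 𝔽 V W y) = y := by
  rw [lieW, FreeLie.map_map, LinearMap.snd_comp_inr, FreeLie.map_id]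

theorem lieW_injective : Function.Injective (lieW 𝔽 V W) :=
  Function.LeftInverse.injective (g := FreeLie.map (LinearMap.snd 𝔽 V W)) map_snd_lieW

/-- The image is the ideal generated by V, and the projection to F(W) kills V. -/
theorem map_snd_lieOrbit (z : FreeLie 𝔽 (tensorOrbit 𝔽 V W)) :
    FreeLie.map (LinearMap.snd 𝔽 V W) (lieOrbit 𝔽 V W z) = 0 := by
  have h : lieOrbit 𝔽 V W z ∈
      (LieSubmodule.lieSpan 𝔽 (FreeLie 𝔽 (V × W)) (Set.range (inclV 𝔽 V W))).toSubmodule := by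
    rw [lieSpan_inclV_eq_range_lieOrbit]
    exact ⟨z, rfl⟩
  have hle : LieSubmodule.lieSpan 𝔽 (FreeLie 𝔽 (V × W)) (Set.range (inclV 𝔽 V W)) ≤
      (FreeLie.map (𝔽 := 𝔽) (LinearMap.snd 𝔽 V W)).ker := by
    refine LieSubmodule.lieSpan_le.2 ?_
    rintro _ ⟨y, rfl⟩
    simp [inclV, FreeLie.map, FreeLie.lift_ι]
  exact LieHom.mem_ker.1 (hle h)

/-! ### The semidirect product decomposition -/

variable (𝔽 V W) in
/-- The action of `F(W)` on `F(T(W) · V)` which corresponds to the adjoint action. -/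
def orbitAd (y : FreeLie 𝔽 W) : Module.End 𝔽 (FreeLie 𝔽 (tensorOrbit 𝔽 V W)) :=
  (LinearEquiv.ofInjective (lieOrbit 𝔽 V W).toLinearMap lieOrbit_injective).symm.toLinearMap ∘ₗ
    ((LieAlgebra.ad 𝔽 (FreeLie 𝔽 (V × W)) (lieW 𝔽 V W y)) ∘ₗ
      (lieOrbit 𝔽 V W).toLinearMap).codRestrict (lieOrbit 𝔽 V W).toLinearMap.range
        fun z => lie_mem_range_lieOrbit _ _ ⟨z, rfl⟩

theorem lieOrbit_orbitAd (y : FreeLie 𝔽 W) (z : FreeLie 𝔽 (tensorOrbit 𝔽 V W)) :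
    lieOrbit 𝔽 V W (orbitAd 𝔽 V W y z) = ⁅lieW 𝔽 V W y, lieOrbit 𝔽 V W z⁆ := by
  have h := LinearEquiv.apply_symm_apply
    (LinearEquiv.ofInjective (lieOrbit 𝔽 V W).toLinearMap lieOrbit_injective)
    ⟨⁅lieW 𝔽 V W y, lieOrbit 𝔽 V W z⁆, lie_mem_range_lieOrbit _ _ ⟨z, rfl⟩⟩
  exact congrArg Subtype.val h

variable (𝔽 V W) in
/-- The action of `F(W)` on `F(T(W) · V)` by derivations. -/
def orbitDerivation : FreeLie 𝔽 W →ₗ⁅𝔽⁆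
    LieDerivation 𝔽 (FreeLie 𝔽 (tensorOrbit 𝔽 V W)) (FreeLie 𝔽 (tensorOrbit 𝔽 V W)) where
  toFun y :=
    { toLinearMap := orbitAd 𝔽 V W y
      leibniz' := fun a b => lieOrbit_injective (by
        rw [lieOrbit_orbitAd, LieHom.map_lie, map_sub, LieHom.map_lie, LieHom.map_lie,
          lieOrbit_orbitAd, lieOrbit_orbitAd, leibniz_lie, ← lie_skew (lieOrbit 𝔽 V W b)]
        abel) }
  map_add' a b := LieDerivation.ext fun z => lieOrbit_injective (by
    change lieOrbit 𝔽 V W (orbitAd 𝔽 V W (a + b) z) =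
      lieOrbit 𝔽 V W (orbitAd 𝔽 V W a z + orbitAd 𝔽 V W b z)
    simp only [lieOrbit_orbitAd, map_add, add_lie])
  map_smul' c a := LieDerivation.ext fun z => lieOrbit_injective (by
    change lieOrbit 𝔽 V W (orbitAd 𝔽 V W (c • a) z) = lieOrbit 𝔽 V W (c • orbitAd 𝔽 V W a z)
    simp only [lieOrbit_orbitAd, map_smul, smul_lie])
  map_lie' {a b} := LieDerivation.ext fun z => lieOrbit_injective (by
    rw [LieDerivation.commutator_apply]
    change lieOrbit 𝔽 V W (orbitAd 𝔽 V W ⁅a, b⁆ z) = lieOrbit 𝔽 V W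
      (orbitAd 𝔽 V W a (orbitAd 𝔽 V W b z) - orbitAd 𝔽 V W b (orbitAd 𝔽 V W a z))
    simp only [lieOrbit_orbitAd, map_sub, LieHom.map_lie, lie_lie])

theorem lieOrbit_orbitDerivation (y : FreeLie 𝔽 W) (z : FreeLie 𝔽 (tensorOrbit 𝔽 V W)) :
    lieOrbit 𝔽 V W (orbitDerivation 𝔽 V W y z) = ⁅lieW 𝔽 V W y, lieOrbit 𝔽 V W z⁆ :=
  lieOrbit_orbitAd y z

variable (𝔽 V W) in
/-- The canonical homomorphism `F(T(W) · V) ⋊ F(W) → F(V ⊕ W)`. -/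
def semidirectHom : LieAlgebra.SemiDirectSum (FreeLie 𝔽 (tensorOrbit 𝔽 V W)) (FreeLie 𝔽 W)
    (orbitDerivation 𝔽 V W) →ₗ⁅𝔽⁆ FreeLie 𝔽 (V × W) where
  toFun p := lieOrbit 𝔽 V W p.left + lieW 𝔽 V W p.right
  map_add' p q := by
    rw [LieAlgebra.SemiDirectSum.add_eq_mk, map_add, map_add]
    abel
  map_smul' c p := by
    rw [LieAlgebra.SemiDirectSum.smul_eq_mk, map_smul, map_smul, RingHom.id_apply, smul_add]
  map_lie' {p q} := by
    rw [LieAlgebra.SemiDirectSum.lie_eq_mk]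
    simp only [map_add, map_sub, LieHom.map_lie, lieOrbit_orbitDerivation, add_lie, lie_add]
    rw [← lie_skew (lieOrbit 𝔽 V W p.left) (lieW 𝔽 V W q.right)]
    abel

theorem semidirectHom_apply (p : LieAlgebra.SemiDirectSum (FreeLie 𝔽 (tensorOrbit 𝔽 V W))
    (FreeLie 𝔽 W) (orbitDerivation 𝔽 V W)) :
    semidirectHom 𝔽 V W p = lieOrbit 𝔽 V W p.left + lieW 𝔽 V W p.right := rfl

/-- The projection to F(W) reads off the right component, and injectivity of `lieOrbit` then gives
the left one. The range is a Lie subalgebra that contains V ⊕ W. -/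
theorem semidirectHom_bijective : Function.Bijective (semidirectHom 𝔽 V W) := by
  constructor
  · intro p q h
    rw [semidirectHom_apply, semidirectHom_apply] at h
    have hr : p.right = q.right := by
      have := congrArg (FreeLie.map (LinearMap.snd 𝔽 V W)) h
      simpa [map_snd_lieOrbit, map_snd_lieW] using this
    rw [hr, add_left_inj] at h
    exact LieAlgebra.SemiDirectSum.ext (lieOrbit_injective h) hr
  · intro z
    change z ∈ (semidirectHom 𝔽 V W).range
    induction z using FreeLie.induction with
    | ι m =>
      refine ⟨⟨FreeLie.ι 𝔽 _ ⟨_, inclV_mem_tensorOrbit m.1⟩, FreeLie.ι 𝔽 W m.2⟩, ?_⟩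
      change lieOrbit 𝔽 V W _ + lieW 𝔽 V W _ = _
      rw [lieOrbit_ι, lieW_ι, ← ι_prod]
    | add a b ha hb => exact add_mem ha hb
    | smul c a ha => exact LieSubalgebra.smul_mem _ c ha
    | lie a b ha hb => exact LieSubalgebra.lie_mem _ ha hb

end Orbit

end Elimination

end

theorem corollary2p5 (𝔽 : Type u) [Field 𝔽] (V : Type v) [AddCommGroup V] [Module 𝔽 V]
    (W : Type w) [AddCommGroup W] [Module 𝔽 W] :
    -- `F(W) ⊆ F(V ⊕ W) ⊆ T(V ⊕ W)`, `F(W) ⊆ T(W) ⊆ T(V ⊕ W)` and `U(F(W)) = T(W)`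
    (Function.Injective (lieW 𝔽 V W) ∧ Function.Injective (tensorW 𝔽 V W) ∧
      Function.Injective (FreeLie.toTensor 𝔽 W) ∧
      Function.Injective (FreeLie.toTensor 𝔽 (V × W)) ∧
      Function.Bijective (UniversalEnvelopingAlgebra.lift 𝔽 (FreeLie.toTensor 𝔽 W))) ∧
    -- the action of `T(W) = U(F(W))` on `F(V ⊕ W)` extends the adjoint action of `F(W)`, and is
    -- the restriction of the adjoint action of the Hopf algebra `T(W)` on `T(V ⊕ W)`
    ((∀ (y : FreeLie 𝔽 W) (x : FreeLie 𝔽 (V × W)),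
        lieAction 𝔽 V W (FreeLie.toTensor 𝔽 W y) x = ⁅lieW 𝔽 V W y, x⁆) ∧
      ∀ (t : TensorAlgebra 𝔽 W) (x : FreeLie 𝔽 (V × W)),
        FreeLie.toTensor 𝔽 (V × W) (lieAction 𝔽 V W t x) =
          adjointAction (tensorW 𝔽 V W) t (FreeLie.toTensor 𝔽 (V × W) x)) ∧
    -- `T(W) · V` is the `F(W)`-submodule generated by `V`, and it is the free module over `V`
    ((LieSubmodule.lieSpan 𝔽 (lieW 𝔽 V W).range (Set.range (inclV 𝔽 V W))).toSubmodule =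
        tensorOrbit 𝔽 V W ∧
      ∃ e : TensorAlgebra 𝔽 W ⊗[𝔽] V ≃ₗ[𝔽] tensorOrbit 𝔽 V W,
        ∀ (t : TensorAlgebra 𝔽 W) (v : V),
          (e (t ⊗ₜ v) : FreeLie 𝔽 (V × W)) = lieAction 𝔽 V W t (inclV 𝔽 V W v)) ∧
    -- the Lie subalgebra generated by `T(W) · V` is `F(T(W) · V)`
    (∃ e : FreeLie 𝔽 (tensorOrbit 𝔽 V W) ≃ₗ⁅𝔽⁆
          LieSubalgebra.lieSpan 𝔽 (FreeLie 𝔽 (V × W)) (tensorOrbit 𝔽 V W : Set _),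
        ∀ z, (e z : FreeLie 𝔽 (V × W)) = lieOrbit 𝔽 V W z) ∧
    -- the associative subalgebra generated by `T(W) · V` is `T(T(W) · V)`
    (∃ e : TensorAlgebra 𝔽 (tensorOrbit 𝔽 V W) ≃ₐ[𝔽]
          Algebra.adjoin 𝔽 (FreeLie.toTensor 𝔽 (V × W) '' (tensorOrbit 𝔽 V W : Set _)),
        ∀ z, (e z : TensorAlgebra 𝔽 (V × W)) = algOrbit 𝔽 V W z) ∧
    -- `F(V ⊕ W) = F(T(W) · V) ⋊ F(W)`
    (∃ (ψ : FreeLie 𝔽 W →ₗ⁅𝔽⁆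
          LieDerivation 𝔽 (FreeLie 𝔽 (tensorOrbit 𝔽 V W)) (FreeLie 𝔽 (tensorOrbit 𝔽 V W)))
        (e : LieAlgebra.SemiDirectSum (FreeLie 𝔽 (tensorOrbit 𝔽 V W)) (FreeLie 𝔽 W) ψ ≃ₗ⁅𝔽⁆
          FreeLie 𝔽 (V × W)),
        (∀ z, e (LieAlgebra.SemiDirectSum.inl ψ z) = lieOrbit 𝔽 V W z) ∧
          ∀ y, e (LieAlgebra.SemiDirectSum.inr ψ y) = lieW 𝔽 V W y) ∧
    -- `F(T(W) · V)` is the ideal of `F(V ⊕ W)` generated by `V`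
    (LieSubmodule.lieSpan 𝔽 (FreeLie 𝔽 (V × W)) (Set.range (inclV 𝔽 V W))).toSubmodule =
      (lieOrbit 𝔽 V W).range.toSubmodule ∧
    -- `T(V ⊕ W) = T(T(W) · V) # T(W)`
    IsSmashProduct (algOrbit 𝔽 V W) (tensorW 𝔽 V W) := by
  refine ⟨⟨lieW_injective, tensorW_injective, FreeLie.toTensor_injective 𝔽 W,
    FreeLie.toTensor_injective 𝔽 (V × W), (FreeLie.envelopingEquiv 𝔽 W).bijective⟩,
    ⟨lieAction_toTensor, toTensor_lieAction⟩, ⟨lieSpan_lieW_range_inclV, ?_⟩, ?_, ?_, ?_,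
    lieSpan_inclV_eq_range_lieOrbit, isSmashProduct_algOrbit⟩
  · exact ⟨(LinearEquiv.ofInjective _ orbitMap_injective).trans
      (LinearEquiv.ofEq _ _ range_orbitMap), orbitMap_tmul⟩
  · exact ⟨(LieEquiv.ofInjective _ lieOrbit_injective).trans
      (LieEquiv.ofEq _ _ (congrArg _ range_lieOrbit)), fun _ => rfl⟩
  · exact ⟨(AlgEquiv.ofInjective _ algOrbit_injective).trans
      (Subalgebra.equivOfEq _ _ range_algOrbit), fun _ => rfl⟩
  · refine ⟨orbitDerivation 𝔽 V W, LieEquiv.ofBijective _ semidirectHom_bijective, fun z => ?_,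
      fun y => ?_⟩
    · change lieOrbit 𝔽 V W z + lieW 𝔽 V W 0 = _
      rw [map_zero, add_zero]
    · change lieOrbit 𝔽 V W 0 + lieW 𝔽 V W y = _
      rw [map_zero, zero_add]
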